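/- Let $(M,\varphi,\zeta,\eta,g_M)$ be a Sasakian manifold with Levi-Civita connection $\nabla$: $\varphi$ is a $(1,1)$-tensor field, $\zeta$ a vector field, $\eta$ a $1$-form and $g_M$ a Riemannian metric with $$\varphi^2P=-P+\eta(P)\zeta,\quad \varphi\zeta=0,\quad \eta\circ\varphi=0,\quad \eta(\zeta)=1,\quad g_M(P,\zeta)=\eta(P),$$ $$g_M(\varphi P,\varphi Q)=g_M(P,Q)-\eta(P)\eta(Q),\quad g_M(\varphi P,Q)=-g_M(P,\varphi Q),$$ $$(\nabla_P\varphi)Q=g_M(P,Q)\zeta-\eta(Q)P,\quad \nabla_P\zeta=-\varphi P$$ for all vector fields $P,Q$. Let $(N,g_N)$ be a Riemannian manifold with $\dim N<\dim M$, and let $\Psi:M\to N$ be a semi-invariant conformal $\zeta^\perp$-Riemannian submersion with dilation $\lambda:M\to(0,\infty)$. This means that $\Psi$ is a smooth surjective submersion with $g_N(\Psi_*X,\Psi_*Y)=\lambda^2g_M(X,Y)$ for all $X,Y\in(\ker\Psi_*)^\perp$, that $\zeta$ is orthogonal to $\ker\Psi_*$, and that there is a smooth distribution $D_1\subseteq\ker\Psi_*$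 such that, with $D_2$ the orthogonal complement of $D_1$ in $\ker\Psi_*$, one has $\varphi(D_1)=D_1$ and $\varphi(D_2)\subseteq(\ker\Psi_*)^\perp$. Let $\mathcal V$ and $\mathcal H$ be the orthogonal projections onto $\ker\Psi_*$ and $(\ker\Psi_*)^\perp$. Let $\mu$ be the orthogonal complement of $\varphi D_2$ in $(\ker\Psi_*)^\perp$, and for $Z\in(\ker\Psi_*)^\perp$ write $\varphi Z=\alpha Z+\beta Z$ with $\alpha Z\in D_2$ and $\beta Z\in\mu$. Let $T_XY=\mathcal H\nabla_{\mathcal VX}\mathcal VY+\mathcal V\nabla_{\mathcal VX}\mathcal HY$ be O'Neill's tensor. Let $\nabla^\Psi$ be the pullback to $\Psi^{-1}TN$ of the Levi-Civita connection of $N$, and let $(\nabla\Psi_*)(X,Y)=\nabla^\Psi_X\Psi_*Y-\Psi_*(\nabla_XY)$ be the second fundamental form of $\Psi$. Then $D_2$ defines a totally geodesic foliation on $M$ (that is, $D_2$ is involutive and $\nabla_W\xi\in\Gamma(D_2)$ for all $W,\xi\in\Gamma(D_2)$) if and only if both of the following conditions hold: 1. $(\nabla\Psi_*)(W,\varphi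 U)\in\Gamma(\Psi_*\mu)$ for all $W\in\Gamma(D_2)$ and $U\in\Gamma(D_1)$; 2. for all $W,\xi\in\Gamma(D_2)$ and $Z\in\Gamma((\ker\Psi_*)^\perp)$, $$\frac1{\lambda^2}\,g_N\big(\nabla^\Psi_{\varphi\xi}\Psi_*\varphi W,\ \Psi_*\varphi\beta Z\big)=g_M(\varphi\xi,T_W\alpha Z)-g_M(W,\xi)\,g_M(\mathcal H\,\mathrm{grad}\ln\lambda,\ \varphi\beta Z)+\eta(\beta Z)\,g_M(W,\xi).$$ -/

import Mathlib

open Bundle FiberBundle VectorField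
open scoped Manifold ContDiff

noncomputable section

namespace SicSubmersion

section LeviCivita

variable {E : Type*} [NormedAddCommGroup E] [NormedSpace ℝ E]
  {M : Type*} [TopologicalSpace M] [ChartedSpace E M]
  [RiemannianBundle (fun x : M ↦ TangentSpace 𝓘(ℝ, E) x)]

/-- The right-hand side of Koszul's formula for `g(∇_X Y, Z)` at the point `x`. -/
def koszul [IsManifold 𝓘(ℝ, E) ∞ M] (Y X Z : Π x : M, TangentSpace 𝓘(ℝ, E) x) (x : M) : ℝ :=
  (d% (fun y ↦ inner ℝ (Y y) (Z y)) x (X x) + d% (fun y ↦ inner ℝ (X y) (Z y)) x (Y x)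
    - d% (fun y ↦ inner ℝ (X y) (Y y)) x (Z x)
    + inner ℝ (mlieBracket 𝓘(ℝ, E) X Y x) (Z x) - inner ℝ (mlieBracket 𝓘(ℝ, E) X Z x) (Y x)
    - inner ℝ (mlieBracket 𝓘(ℝ, E) Y Z x) (X x)) / 2

section Dual

variable [FiniteDimensional ℝ E]

instance tangentSpace_finiteDimensional (x : M) :
    FiniteDimensional ℝ (TangentSpace 𝓘(ℝ, E) x) :=
  inferInstanceAs (FiniteDimensional ℝ E)

/-- The vector dual to a covector with respect to the metric. -/
def sharp (x : M) : (TangentSpace 𝓘(ℝ, E) x →L[ℝ] ℝ) →L[ℝ] TangentSpace 𝓘(ℝ, E) x :=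
  haveI := FiniteDimensional.complete ℝ (TangentSpace 𝓘(ℝ, E) x)
  (InnerProductSpace.toDual ℝ
    (TangentSpace 𝓘(ℝ, E) x)).symm.toContinuousLinearEquiv.toContinuousLinearMap

theorem inner_sharp (x : M) (a : TangentSpace 𝓘(ℝ, E) x →L[ℝ] ℝ) (v : TangentSpace 𝓘(ℝ, E) x) :
    inner ℝ (sharp x a) v = a v := by
  have := FiniteDimensional.complete ℝ (TangentSpace 𝓘(ℝ, E) x)
  exact InnerProductSpace.toDual_symm_apply (𝕜 := ℝ) (E := TangentSpace 𝓘(ℝ, E) x)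

end Dual

variable [IsManifold 𝓘(ℝ, E) ∞ M]
  [IsContMDiffRiemannianBundle 𝓘(ℝ, E) ∞ E (fun x : M ↦ TangentSpace 𝓘(ℝ, E) x)]

theorem mdifferentiableAt_inner {X Y : Π x : M, TangentSpace 𝓘(ℝ, E) x} {x : M}
    (hX : MDiffAt (T% X) x) (hY : MDiffAt (T% Y) x) : MDiffAt (fun y ↦ inner ℝ (X y) (Y y)) x :=
  MDifferentiableAt.inner_bundle (E := fun x : M ↦ TangentSpace 𝓘(ℝ, E) x) hX hY

variable [FiniteDimensional ℝ E]

theorem koszul_tensorial_left {Y Z : Π x : M, TangentSpace 𝓘(ℝ, E) x} {x : M}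
    (hY : MDiffAt (T% Y) x) (hZ : MDiffAt (T% Z) x) :
    TensorialAt 𝓘(ℝ, E) E (koszul Y · Z x) x where
  smul {f X} hf hX := by
    have := FiniteDimensional.complete ℝ E
    have h1 := mvfderiv_mul hf (mdifferentiableAt_inner hX hZ)
    have h2 := mvfderiv_mul hf (mdifferentiableAt_inner hX hY)
    simp only [koszul, Pi.smul_apply', real_inner_smul_left, real_inner_smul_right]
    simp only [Pi.mul_def] at h1 h2
    rw [h1, h2, mlieBracket_smul_left hf hX, mlieBracket_smul_left hf hX]
    simp [inner_add_left, real_inner_smul_left]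
    ring
  add {X X'} hX hX' := by
    have := FiniteDimensional.complete ℝ E
    have h1 := mvfderiv_add (mdifferentiableAt_inner hX hZ) (mdifferentiableAt_inner hX' hZ)
    have h2 := mvfderiv_add (mdifferentiableAt_inner hX hY) (mdifferentiableAt_inner hX' hY)
    simp only [Pi.add_def] at h1 h2
    simp only [koszul, Pi.add_apply, inner_add_left, inner_add_right]
    rw [h1, h2, mlieBracket_add_left hX hX', mlieBracket_add_left hX hX']
    simp [inner_add_left]
    ring

theorem koszul_tensorial_right {Y X : Π x : M, TangentSpace 𝓘(ℝ, E) x} {x : M}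
    (hY : MDiffAt (T% Y) x) (hX : MDiffAt (T% X) x) :
    TensorialAt 𝓘(ℝ, E) E (koszul Y X · x) x where
  smul {f Z} hf hZ := by
    have := FiniteDimensional.complete ℝ E
    have h1 := mvfderiv_mul hf (mdifferentiableAt_inner hY hZ)
    have h2 := mvfderiv_mul hf (mdifferentiableAt_inner hX hZ)
    simp only [Pi.mul_def] at h1 h2
    simp only [koszul, Pi.smul_apply', real_inner_smul_right]
    rw [h1, h2, mlieBracket_smul_right hf hZ, mlieBracket_smul_right hf hZ]
    simp [inner_add_left, real_inner_smul_left]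
    rw [real_inner_comm (Z x) (X x), real_inner_comm (Z x) (Y x)]
    ring
  add {Z Z'} hZ hZ' := by
    have := FiniteDimensional.complete ℝ E
    have h1 := mvfderiv_add (mdifferentiableAt_inner hY hZ) (mdifferentiableAt_inner hY hZ')
    have h2 := mvfderiv_add (mdifferentiableAt_inner hX hZ) (mdifferentiableAt_inner hX hZ')
    simp only [Pi.add_def] at h1 h2
    simp only [koszul, Pi.add_apply, inner_add_right]
    rw [h1, h2, mlieBracket_add_right hZ hZ', mlieBracket_add_right hZ hZ']
    simp [inner_add_left]
    ring

open Classical in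
/-- The map underlying the Levi-Civita connection: `leviCivitaFun Y x` sends `X x` to the vector
whose inner product with `Z x` is given by Koszul's formula (and it is set to `0` if `Y` is not
differentiable at `x`). -/
def leviCivitaFun (Y : Π x : M, TangentSpace 𝓘(ℝ, E) x) (x : M) :
    TangentSpace 𝓘(ℝ, E) x →L[ℝ] TangentSpace 𝓘(ℝ, E) x :=
  if hY : MDiffAt (T% Y) x then
    sharp x ∘L TensorialAt.mkHom₂ (I := 𝓘(ℝ, E)) (F := E) (F' := E) (fun X Z ↦ koszul Y X Z x) x
      (fun _ hZ ↦ koszul_tensorial_left hY hZ) (fun _ hX ↦ koszul_tensorial_right hY hX)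
  else 0

theorem inner_leviCivitaFun {X Y Z : Π x : M, TangentSpace 𝓘(ℝ, E) x} {x : M}
    (hX : MDiffAt (T% X) x) (hY : MDiffAt (T% Y) x) (hZ : MDiffAt (T% Z) x) :
    inner ℝ (leviCivitaFun Y x (X x)) (Z x) = koszul Y X Z x := by
  rw [leviCivitaFun, dif_pos hY]
  simp only [ContinuousLinearMap.comp_apply, inner_sharp]
  exact TensorialAt.mkHom₂_apply _ _ hX hZ

theorem inner_leviCivitaFun_extend {Y : Π x : M, TangentSpace 𝓘(ℝ, E) x} {x : M}
    (hY : MDiffAt (T% Y) x) (u v : TangentSpace 𝓘(ℝ, E) x) :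
    inner ℝ (leviCivitaFun Y x u) v = koszul Y (extend E u) (extend E v) x := by
  simpa using inner_leviCivitaFun (mdifferentiableAt_extend 𝓘(ℝ, E) E u) hY
    (mdifferentiableAt_extend 𝓘(ℝ, E) E v)

variable (E M) in
/-- The Levi-Civita connection of the Riemannian metric, built from Koszul's formula.
The covariant derivative `∇_X Y` at `x` is `leviCivita E M Y x (X x)`. -/
def leviCivita : CovariantDerivative 𝓘(ℝ, E) E (fun x : M ↦ TangentSpace 𝓘(ℝ, E) x) where
  toFun := leviCivitaFun
  isCovariantDerivativeOnUniv :=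
    { add := by
        intro Y Y' x hY hY' _
        have := FiniteDimensional.complete ℝ E
        refine ContinuousLinearMap.ext fun u ↦ ext_inner_right ℝ fun v ↦ ?_
        have hu := mdifferentiableAt_extend 𝓘(ℝ, E) E u
        have hv := mdifferentiableAt_extend 𝓘(ℝ, E) E v
        rw [add_apply, inner_add_left, inner_leviCivitaFun_extend hY,
          inner_leviCivitaFun_extend hY', inner_leviCivitaFun_extend
            (mdifferentiableAt_add_section hY hY')]
        have h1 := mvfderiv_add (mdifferentiableAt_inner hY hv) (mdifferentiableAt_inner hY' hv)
        have h2 := mvfderiv_add (mdifferentiableAt_inner hu hY) (mdifferentiableAt_inner hu hY')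
        simp only [Pi.add_def] at h1 h2
        simp only [koszul, Pi.add_apply, inner_add_left, inner_add_right]
        rw [h1, h2, mlieBracket_add_right hY hY', mlieBracket_add_left hY hY']
        simp [inner_add_left]
        ring
      leibniz := by
        intro Y f x hY hf _
        have := FiniteDimensional.complete ℝ E
        refine ContinuousLinearMap.ext fun u ↦ ext_inner_right ℝ fun v ↦ ?_
        have hu := mdifferentiableAt_extend 𝓘(ℝ, E) E u
        have hv := mdifferentiableAt_extend 𝓘(ℝ, E) E v
        rw [add_apply, smul_apply, inner_add_left,
          real_inner_smul_left, inner_leviCivitaFun_extend hY,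
          inner_leviCivitaFun_extend (hf.smul_section hY)]
        have h1 := mvfderiv_mul hf (mdifferentiableAt_inner hY hv)
        have h2 := mvfderiv_mul hf (mdifferentiableAt_inner hu hY)
        simp only [Pi.mul_def] at h1 h2
        simp only [koszul, Pi.smul_apply', real_inner_smul_left, real_inner_smul_right]
        rw [h1, h2, mlieBracket_smul_right hf hY, mlieBracket_smul_left hf hY]
        simp [inner_add_left, real_inner_smul_left]
        rw [real_inner_comm (Y x) u]
        ring }

/-- The Levi-Civita connection is compatible with the metric. -/
theorem leviCivita_metric {Y Z : Π x : M, TangentSpace 𝓘(ℝ, E) x} {x : M}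
    (hY : MDiffAt (T% Y) x) (hZ : MDiffAt (T% Z) x) (u : TangentSpace 𝓘(ℝ, E) x) :
    d% (fun y ↦ inner ℝ (Y y) (Z y)) x u =
      inner ℝ (leviCivita E M Y x u) (Z x) + inner ℝ (Y x) (leviCivita E M Z x u) := by
  have := FiniteDimensional.complete ℝ E
  have hu := mdifferentiableAt_extend 𝓘(ℝ, E) E u
  have h1 := inner_leviCivitaFun hu hY hZ
  have h2 := inner_leviCivitaFun hu hZ hY
  rw [extend_apply_self] at h1 h2
  rw [real_inner_comm (leviCivita E M Z x u) (Y x)]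
  change _ = inner ℝ (leviCivitaFun Y x u) (Z x) + inner ℝ (leviCivitaFun Z x u) (Y x)
  have h3 : (fun y ↦ inner ℝ (Z y) (Y y)) = fun y ↦ inner ℝ (Y y) (Z y) := by
    funext y
    exact real_inner_comm _ _
  rw [h1, h2, koszul, koszul, h3, extend_apply_self,
    mlieBracket_swap_apply (I := 𝓘(ℝ, E)) (V := Z) (W := Y), inner_neg_left]
  ring

/-- The Levi-Civita connection is torsion-free. -/
theorem leviCivita_torsionFree {X Y : Π x : M, TangentSpace 𝓘(ℝ, E) x} {x : M}
    (hX : MDiffAt (T% X) x) (hY : MDiffAt (T% Y) x) :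
    leviCivita E M Y x (X x) - leviCivita E M X x (Y x) = mlieBracket 𝓘(ℝ, E) X Y x := by
  have := FiniteDimensional.complete ℝ E
  refine ext_inner_right ℝ fun v ↦ ?_
  have hv := mdifferentiableAt_extend 𝓘(ℝ, E) E v
  have h1 := inner_leviCivitaFun hX hY hv
  have h2 := inner_leviCivitaFun hY hX hv
  rw [extend_apply_self] at h1 h2
  rw [inner_sub_left]
  change inner ℝ (leviCivitaFun Y x (X x)) v - inner ℝ (leviCivitaFun X x (Y x)) v = _
  have h3 : (fun y ↦ inner ℝ (Y y) (X y)) = fun y ↦ inner ℝ (X y) (Y y) := by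
    funext y
    exact real_inner_comm _ _
  rw [h1, h2, koszul, koszul, h3, extend_apply_self,
    mlieBracket_swap_apply (I := 𝓘(ℝ, E)) (V := Y) (W := X), inner_neg_left]
  ring

end LeviCivita

section Geometry

variable {E : Type*} [NormedAddCommGroup E] [NormedSpace ℝ E]
  {M : Type*} [TopologicalSpace M] [ChartedSpace E M]

/-- Smooth vector fields. -/
def IsSmoothField [IsManifold 𝓘(ℝ, E) ∞ M] (X : Π x : M, TangentSpace 𝓘(ℝ, E) x) : Prop :=
  ContMDiff 𝓘(ℝ, E) 𝓘(ℝ, E).tangent ∞ (fun x ↦ (⟨x, X x⟩ : TangentBundle 𝓘(ℝ, E) M))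

/-- `X ∈ Γ(D)`: a smooth vector field with values in the distribution `D`. -/
def IsSection [IsManifold 𝓘(ℝ, E) ∞ M] (D : Π x : M, Submodule ℝ (TangentSpace 𝓘(ℝ, E) x))
    (X : Π x : M, TangentSpace 𝓘(ℝ, E) x) : Prop :=
  IsSmoothField X ∧ ∀ x, X x ∈ D x

/-- Smooth distributions: near each point, `D` has a smooth frame. -/
def IsSmoothDistribution [IsManifold 𝓘(ℝ, E) ∞ M]
    (D : Π x : M, Submodule ℝ (TangentSpace 𝓘(ℝ, E) x)) : Prop :=
  ∀ x : M, ∃ (U : Set M) (k : ℕ) (e : Fin k → Π y : M, TangentSpace 𝓘(ℝ, E) y),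
    IsOpen U ∧ x ∈ U ∧
    (∀ i, ContMDiffOn 𝓘(ℝ, E) 𝓘(ℝ, E).tangent ∞
      (fun y ↦ (⟨y, e i y⟩ : TangentBundle 𝓘(ℝ, E) M)) U) ∧
    ∀ y ∈ U, LinearIndependent ℝ (fun i ↦ e i y) ∧
      Submodule.span ℝ (Set.range fun i ↦ e i y) = D y

variable [FiniteDimensional ℝ E] [IsManifold 𝓘(ℝ, E) ∞ M]
  [RiemannianBundle (fun x : M ↦ TangentSpace 𝓘(ℝ, E) x)]

/-- The gradient of a function. -/
def grad (f : M → ℝ) (x : M) : TangentSpace 𝓘(ℝ, E) x := sharp x (d% f x)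

/-- An almost contact metric structure `(φ, ζ, η)` on the Riemannian manifold `M`. (The form `η` is
smooth because of `inner_reeb`.) -/
structure IsAlmostContactMetric (φ : Π x : M, TangentSpace 𝓘(ℝ, E) x →L[ℝ] TangentSpace 𝓘(ℝ, E) x)
    (ζ : Π x : M, TangentSpace 𝓘(ℝ, E) x) (η : Π x : M, TangentSpace 𝓘(ℝ, E) x →L[ℝ] ℝ) :
    Prop where
  smooth_phi : ContMDiff 𝓘(ℝ, E) (𝓘(ℝ, E).prod 𝓘(ℝ, E →L[ℝ] E)) ∞
    (fun x ↦ TotalSpace.mk' (E →L[ℝ] E)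
      (E := fun x : M ↦ TangentSpace 𝓘(ℝ, E) x →L[ℝ] TangentSpace 𝓘(ℝ, E) x) x (φ x))
  smooth_reeb : IsSmoothField ζ
  phi_phi : ∀ x (P : TangentSpace 𝓘(ℝ, E) x), φ x (φ x P) = -P + η x P • ζ x
  phi_reeb : ∀ x, φ x (ζ x) = 0
  eta_phi : ∀ x (P : TangentSpace 𝓘(ℝ, E) x), η x (φ x P) = 0
  eta_reeb : ∀ x, η x (ζ x) = 1
  inner_reeb : ∀ x (P : TangentSpace 𝓘(ℝ, E) x), inner ℝ P (ζ x) = η x P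
  inner_phi_phi : ∀ x (P Q : TangentSpace 𝓘(ℝ, E) x),
    inner ℝ (φ x P) (φ x Q) = inner ℝ P Q - η x P * η x Q
  inner_phi : ∀ x (P Q : TangentSpace 𝓘(ℝ, E) x), inner ℝ (φ x P) Q = -inner ℝ P (φ x Q)

variable [IsContMDiffRiemannianBundle 𝓘(ℝ, E) ∞ E (fun x : M ↦ TangentSpace 𝓘(ℝ, E) x)]

/-- `∇_X Y` for the Levi-Civita connection of `M`. -/
def nabla (X Y : Π x : M, TangentSpace 𝓘(ℝ, E) x) (x : M) : TangentSpace 𝓘(ℝ, E) x :=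
  leviCivita E M Y x (X x)

/-- A Sasakian structure: `(∇_P φ) Q = g(P, Q) ζ - η(Q) P` and `∇_P ζ = -φ P`, where
`(∇_P φ) Q = ∇_P (φ Q) - φ (∇_P Q)`. -/
structure IsSasakian (φ : Π x : M, TangentSpace 𝓘(ℝ, E) x →L[ℝ] TangentSpace 𝓘(ℝ, E) x)
    (ζ : Π x : M, TangentSpace 𝓘(ℝ, E) x) (η : Π x : M, TangentSpace 𝓘(ℝ, E) x →L[ℝ] ℝ) :
    Prop extends IsAlmostContactMetric φ ζ η where
  nabla_phi : ∀ P Q : Π x : M, TangentSpace 𝓘(ℝ, E) x, IsSmoothField P → IsSmoothField Q → ∀ x,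
    nabla P (fun y ↦ φ y (Q y)) x - φ x (nabla P Q x) =
      inner ℝ (P x) (Q x) • ζ x - η x (Q x) • P x
  nabla_reeb : ∀ P : Π x : M, TangentSpace 𝓘(ℝ, E) x, IsSmoothField P → ∀ x,
    nabla P ζ x = -φ x (P x)

/-- `D` defines a totally geodesic foliation: it is involutive (hence tangent to a foliation) and
the second fundamental forms of its leaves vanish, i.e. `∇_X Y ∈ Γ(D)` for all `X, Y ∈ Γ(D)`. -/
def DefinesTotallyGeodesicFoliation
    (D : Π x : M, Submodule ℝ (TangentSpace 𝓘(ℝ, E) x)) : Prop :=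
  (∀ X Y, IsSection D X → IsSection D Y → ∀ x, mlieBracket 𝓘(ℝ, E) X Y x ∈ D x) ∧
  (∀ X Y, IsSection D X → IsSection D Y → ∀ x, nabla X Y x ∈ D x)

end Geometry

section Submersion

variable {E : Type*} [NormedAddCommGroup E] [NormedSpace ℝ E] [FiniteDimensional ℝ E]
  {M : Type*} [TopologicalSpace M] [ChartedSpace E M] [IsManifold 𝓘(ℝ, E) ∞ M]
  [RiemannianBundle (fun x : M ↦ TangentSpace 𝓘(ℝ, E) x)]
  [IsContMDiffRiemannianBundle 𝓘(ℝ, E) ∞ E (fun x : M ↦ TangentSpace 𝓘(ℝ, E) x)]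
  {F : Type*} [NormedAddCommGroup F] [NormedSpace ℝ F] [FiniteDimensional ℝ F]
  {N : Type*} [TopologicalSpace N] [ChartedSpace F N] [IsManifold 𝓘(ℝ, F) ∞ N]
  [RiemannianBundle (fun y : N ↦ TangentSpace 𝓘(ℝ, F) y)]
  [IsContMDiffRiemannianBundle 𝓘(ℝ, F) ∞ F (fun y : N ↦ TangentSpace 𝓘(ℝ, F) y)]

variable (F)

/-- The differential `Ψ_*` at `x`. -/
abbrev push (Ψ : M → N) (x : M) : TangentSpace 𝓘(ℝ, E) x →L[ℝ] TangentSpace 𝓘(ℝ, F) (Ψ x) :=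
  mfderiv 𝓘(ℝ, E) 𝓘(ℝ, F) Ψ x

/-- The vertical distribution `ker Ψ_*`. -/
def vertical (Ψ : M → N) (x : M) : Submodule ℝ (TangentSpace 𝓘(ℝ, E) x) :=
  LinearMap.ker (push F Ψ x).toLinearMap

/-- The horizontal distribution `(ker Ψ_*)ᗮ`. -/
def horizontal (Ψ : M → N) (x : M) : Submodule ℝ (TangentSpace 𝓘(ℝ, E) x) :=
  (vertical F Ψ x)ᗮ

/-- The orthogonal projection `𝓥` onto the vertical distribution. -/
def vproj (Ψ : M → N) (x : M) : TangentSpace 𝓘(ℝ, E) x →L[ℝ] TangentSpace 𝓘(ℝ, E) x :=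
  (vertical F Ψ x).starProjection

/-- The orthogonal projection `𝓗` onto the horizontal distribution. -/
def hproj (Ψ : M → N) (x : M) : TangentSpace 𝓘(ℝ, E) x →L[ℝ] TangentSpace 𝓘(ℝ, E) x :=
  (horizontal F Ψ x).starProjection

/-- O'Neill's tensor `T_X Y = 𝓗 ∇_{𝓥X} 𝓥Y + 𝓥 ∇_{𝓥X} 𝓗Y`. -/
def oneillT (Ψ : M → N) (X Y : Π x : M, TangentSpace 𝓘(ℝ, E) x) (x : M) :
    TangentSpace 𝓘(ℝ, E) x :=
  hproj F Ψ x (nabla (fun y ↦ vproj F Ψ y (X y)) (fun y ↦ vproj F Ψ y (Y y)) x) +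
    vproj F Ψ x (nabla (fun y ↦ vproj F Ψ y (X y)) (fun y ↦ hproj F Ψ y (Y y)) x)

/-- The pullback connection `∇^Ψ_X σ` on the bundle `Ψ⁻¹TN`, at the point `x`. Let `e` be the
preferred local trivialization of `TN` around `Ψ x`, with coordinate frame `(e_i)`. If
`σ = ∑ σ^i (e_i ∘ Ψ)` near `x`, then
`∇^Ψ_X σ = ∑ dσ^i(X) e_i + ∑ σ^i(x) ∇^N_{Ψ_* X} e_i`. Here `extend F (σ x)` is the local field
`∑ σ^i(x) e_i`, with constant components in `e`. -/
def pullbackNabla (Ψ : M → N) (X : Π x : M, TangentSpace 𝓘(ℝ, E) x)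
    (σ : Π x : M, TangentSpace 𝓘(ℝ, F) (Ψ x)) (x : M) : TangentSpace 𝓘(ℝ, F) (Ψ x) :=
  let e := trivializationAt F (fun y : N ↦ TangentSpace 𝓘(ℝ, F) y) (Ψ x)
  e.symmL ℝ (Ψ x) (d% (fun y : M ↦ (e ⟨Ψ y, σ y⟩).2) x (X x)) +
    leviCivita F N (extend F (σ x)) (Ψ x) (push F Ψ x (X x))

/-- The second fundamental form `(∇Ψ_*)(X, Y) = ∇^Ψ_X (Ψ_* Y) - Ψ_* (∇_X Y)`. -/
def secondFundamentalForm (Ψ : M → N) (X Y : Π x : M, TangentSpace 𝓘(ℝ, E) x) (x : M) :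
    TangentSpace 𝓘(ℝ, F) (Ψ x) :=
  pullbackNabla F Ψ X (fun y ↦ push F Ψ y (Y y)) x - push F Ψ x (nabla X Y x)

variable (E) in
/-- Horizontally conformal submersions of `M` onto `N` with dilation `dil > 0`. -/
structure IsConformalSubmersion (Ψ : M → N) (dil : M → ℝ) : Prop where
  smooth : ContMDiff 𝓘(ℝ, E) 𝓘(ℝ, F) ∞ Ψ
  onto : Function.Surjective Ψ
  dim_lt : Module.finrank ℝ F < Module.finrank ℝ E
  maximal_rank : ∀ x, Function.Surjective (push (E := E) F Ψ x)
  dil_pos : ∀ x, 0 < dil x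
  conformal : ∀ x, ∀ u ∈ horizontal (E := E) F Ψ x, ∀ v ∈ horizontal (E := E) F Ψ x,
    inner ℝ (push (E := E) F Ψ x u) (push (E := E) F Ψ x v) = dil x ^ 2 * inner ℝ u v

/-- `D₂`, the orthogonal complement of `D₁` in `ker Ψ_*`. -/
def antiInvariant (Ψ : M → N) (D₁ : Π x : M, Submodule ℝ (TangentSpace 𝓘(ℝ, E) x)) (x : M) :
    Submodule ℝ (TangentSpace 𝓘(ℝ, E) x) :=
  vertical F Ψ x ⊓ (D₁ x)ᗮ

/-- `μ`, the orthogonal complement of `φ D₂` in `(ker Ψ_*)ᗮ`. -/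
def muDist (φ : Π x : M, TangentSpace 𝓘(ℝ, E) x →L[ℝ] TangentSpace 𝓘(ℝ, E) x) (Ψ : M → N)
    (D₁ : Π x : M, Submodule ℝ (TangentSpace 𝓘(ℝ, E) x)) (x : M) :
    Submodule ℝ (TangentSpace 𝓘(ℝ, E) x) :=
  horizontal F Ψ x ⊓ ((antiInvariant F Ψ D₁ x).map (φ x).toLinearMap)ᗮ

/-- Semi-invariant conformal `ζᗮ`-Riemannian submersions with dilation `dil`, and with invariant
distribution `D₁` (so that `ker Ψ_* = D₁ ⊕ D₂`). -/
structure IsSicReebPerpSubmersion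
    (φ : Π x : M, TangentSpace 𝓘(ℝ, E) x →L[ℝ] TangentSpace 𝓘(ℝ, E) x)
    (ζ : Π x : M, TangentSpace 𝓘(ℝ, E) x) (Ψ : M → N) (dil : M → ℝ)
    (D₁ : Π x : M, Submodule ℝ (TangentSpace 𝓘(ℝ, E) x)) : Prop
    extends IsConformalSubmersion E F Ψ dil where
  reeb_horizontal : ∀ x, ζ x ∈ horizontal F Ψ x
  smooth_D₁ : IsSmoothDistribution D₁
  D₁_le : ∀ x, D₁ x ≤ vertical F Ψ x
  map_D₁ : ∀ x, (D₁ x).map (φ x).toLinearMap = D₁ x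
  map_D₂ : ∀ x, (antiInvariant F Ψ D₁ x).map (φ x).toLinearMap ≤ horizontal F Ψ x

/-- `α Z`, the `D₂`-component of `φ Z`, for `Z` horizontal. -/
def alphaPart (φ : Π x : M, TangentSpace 𝓘(ℝ, E) x →L[ℝ] TangentSpace 𝓘(ℝ, E) x) (Ψ : M → N)
    (D₁ : Π x : M, Submodule ℝ (TangentSpace 𝓘(ℝ, E) x)) (Z : Π x : M, TangentSpace 𝓘(ℝ, E) x)
    (x : M) : TangentSpace 𝓘(ℝ, E) x :=
  (antiInvariant F Ψ D₁ x).starProjection (φ x (Z x))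

/-- `β Z`, the `μ`-component of `φ Z`, for `Z` horizontal. -/
def betaPart (φ : Π x : M, TangentSpace 𝓘(ℝ, E) x →L[ℝ] TangentSpace 𝓘(ℝ, E) x) (Ψ : M → N)
    (D₁ : Π x : M, Submodule ℝ (TangentSpace 𝓘(ℝ, E) x)) (Z : Π x : M, TangentSpace 𝓘(ℝ, E) x)
    (x : M) : TangentSpace 𝓘(ℝ, E) x :=
  (muDist F φ Ψ D₁ x).starProjection (φ x (Z x))

end Submersion

end SicSubmersion

end

open SicSubmersion

set_option linter.unusedSectionVars false

/-! Write D₂ for `antiInvariant`, and μ₀ for the part of μ orthogonal to ζ (`muReebPerp`); φ maps μ₀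
into itself with square -1. For W, ξ ∈ Γ(D₂) and Y ∈ Γ(μ₀) put a(W, ξ, Y) = g(∇_{φξ} W, Y) and b(W,
ξ, Y) = g(∇_W ξ, Y).

Both conditions translate into statements about ∇. Since Ψ_* φU = 0, condition 1 says exactly that
∇_W ξ has no D₁-component (`secondFundamentalForm_mem_iff`). In condition 2 the formula for the
second fundamental form of a horizontally conformal map cancels the gradient terms, and η(βZ) = 0,
so what is left is a(W, ξ, βZ) = g(φξ, T_W αZ) (`inner_pullbackNabla_phi_eq_iff`). On the other hand
Z = -φαZ - φβZ + η(Z)ζ gives g(∇_W ξ, Z) = -g(φξ, T_W αZ) - b(W, ξ, φβZ) (`inner_nabla_horizontal`).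

The difficulty is that condition 2 controls derivatives along φξ, whereas a totally geodesic D₂
requires control of derivatives along D₂. Testing condition 2 on Z = φY shows that it forces a = 0,
so the crux is that a vanishes identically if and only if b does.

The Reeb field provides the link. It is Killing, its flow preserves φ, and it is horizontal. Hence λ
is constant along the fibres, ∇V is skew on horizontal vectors for V vertical
(`inner_nabla_vertical_skew`), and [ζ, V] has the same horizontal part as 2φV. Consequently
bracketing with ζ preserves D₁ and μ₀, and acts by [ζ, W] = δW + 2φW and [ζ, φW] = φδW - 2W with δW
∈ Γ(D₂): infinitesimally, D₂ is rotated into φD₂.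

Always g(W, [φξ, Y]) = -2a(W, ξ, Y), and differentiating this along ζ trades φξ for ξ. If a = 0, the
derivative reduces to 2b(ξ, W, Y), so b = 0 (`inner_nabla_eq_zero_of_phi`). If b = 0, then also
g([W, φξ], Y) = -a(W, ξ, Y); the ζ-derivatives of the two expressions for a differ by a multiple of
a(W, ξ, φY), so a = 0 (`inner_nabla_phi_eq_zero`). -/

namespace SicSubmersion

/-! ### The Lie bracket as a commutator of derivations -/

section Commutator

variable {E : Type*} [NormedAddCommGroup E] [NormedSpace ℝ E]
  {M : Type*} [TopologicalSpace M] [ChartedSpace E M]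
  {F : Type*} [NormedAddCommGroup F] [NormedSpace ℝ F]

theorem mvfderiv_eq_fderiv {f : M → F} {x : M} (hf : MDiffAt f x) (v : TangentSpace 𝓘(ℝ, E) x) :
    d% f x v = fderiv ℝ (f ∘ (extChartAt 𝓘(ℝ, E) x).symm) (extChartAt 𝓘(ℝ, E) x x) v := by
  rw [hf.mvfderiv]
  simp only [writtenInExtChartAt, modelWithCornersSelf_coe, Set.range_id, fderivWithin_univ]
  rfl

/-- A vector field read in the preferred chart at `x`. -/
noncomputable def fieldInChart (X : Π x : M, TangentSpace 𝓘(ℝ, E) x) (x : M) : E → E :=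
  mpullbackWithin 𝓘(ℝ, E) 𝓘(ℝ, E) (extChartAt 𝓘(ℝ, E) x).symm X (Set.range 𝓘(ℝ, E))

variable [IsManifold 𝓘(ℝ, E) ∞ M]

/-- Chain rule: the derivative of the inverse chart cancels the inverse that enters the pullback of
the field. -/
theorem mvfderiv_symm_eq_fderiv {f : M → F} {x : M} {z : E} {X : Π x : M, TangentSpace 𝓘(ℝ, E) x}
    (hz : z ∈ (extChartAt 𝓘(ℝ, E) x).target)
    (hf : MDiffAt f ((extChartAt 𝓘(ℝ, E) x).symm z)) :
    d% f ((extChartAt 𝓘(ℝ, E) x).symm z) (X ((extChartAt 𝓘(ℝ, E) x).symm z)) =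
      fderiv ℝ (f ∘ (extChartAt 𝓘(ℝ, E) x).symm) z (fieldInChart X x z) := by
  have h1 := isInvertible_mfderivWithin_extChartAt_symm (I := 𝓘(ℝ, E)) hz
  have hs : MDifferentiableWithinAt 𝓘(ℝ, E) 𝓘(ℝ, E) (extChartAt 𝓘(ℝ, E) x).symm
      (Set.range 𝓘(ℝ, E)) z := mdifferentiableWithinAt_extChartAt_symm hz
  have h2 := mfderiv_comp_mfderivWithin (I := 𝓘(ℝ, E)) (I'' := 𝓘(ℝ, F)) z hf hs
    (𝓘(ℝ, E).uniqueMDiffOn z (by simp))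
  have h3 : fderiv ℝ (f ∘ (extChartAt 𝓘(ℝ, E) x).symm) z =
      mfderivWithin 𝓘(ℝ, E) 𝓘(ℝ, F) (f ∘ (extChartAt 𝓘(ℝ, E) x).symm) (Set.range 𝓘(ℝ, E)) z := by
    simp only [modelWithCornersSelf_coe, Set.range_id, mfderivWithin_univ]
    exact mfderiv_eq_fderiv.symm
  rw [h3, h2]
  exact congrArg (d% f ((extChartAt 𝓘(ℝ, E) x).symm z))
    (ContinuousLinearMap.IsInvertible.self_apply_inverse h1 _).symm

theorem fieldInChart_self (X : Π x : M, TangentSpace 𝓘(ℝ, E) x) (x : M) :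
    fieldInChart X x (extChartAt 𝓘(ℝ, E) x x) = X x := by
  have h : (X ((extChartAt 𝓘(ℝ, E) x).symm (extChartAt 𝓘(ℝ, E) x x)) : E) = X x :=
    congrArg (fun y ↦ (X y : E)) (extChartAt_to_inv (I := 𝓘(ℝ, E)) x)
  exact (congrArg (mfderivWithin 𝓘(ℝ, E) 𝓘(ℝ, E) (extChartAt 𝓘(ℝ, E) x).symm (Set.range 𝓘(ℝ, E))
    (extChartAt 𝓘(ℝ, E) x x)).inverse h).trans (mfderivWithin_extChartAt_symm_inverse_apply (X x))

theorem mlieBracket_eq_lieBracket (X Y : Π x : M, TangentSpace 𝓘(ℝ, E) x) (x : M) :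
    mlieBracket 𝓘(ℝ, E) X Y x =
      lieBracket ℝ (fieldInChart X x) (fieldInChart Y x) (extChartAt 𝓘(ℝ, E) x x) := by
  have h : ∀ v : E, (ContinuousLinearMap.id ℝ E).inverse v = v := fun v ↦ by
    rw [ContinuousLinearMap.inverse_id, ContinuousLinearMap.id_apply]
  have hI : Set.range 𝓘(ℝ, E) = Set.univ := by simp
  rw [← lieBracketWithin_univ (V := fieldInChart X x), ← hI]
  rw [mlieBracket, mlieBracketWithin_apply, mfderiv_extChartAt_self, Set.preimage_univ,
    Set.univ_inter]
  exact h _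

theorem differentiableAt_fieldInChart [CompleteSpace E] {X : Π x : M, TangentSpace 𝓘(ℝ, E) x}
    {x : M} (hX : MDiffAt (T% X) x) :
    DifferentiableAt ℝ (fieldInChart X x) (extChartAt 𝓘(ℝ, E) x x) := by
  have h := (mdifferentiableWithinAt_univ.2 hX).differentiableWithinAt_mpullbackWithin_vectorField
  have hI : Set.range 𝓘(ℝ, E) = Set.univ := by simp
  rw [Set.preimage_univ, Set.univ_inter] at h
  rw [← differentiableWithinAt_univ, ← hI]
  exact h

/-- The Lie bracket is the commutator of derivations on vector-valued functions. -/
theorem mvfderiv_mlieBracket [CompleteSpace E] {f : M → F} {x : M}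
    {X Y : Π x : M, TangentSpace 𝓘(ℝ, E) x}
    (hf : ContMDiffAt 𝓘(ℝ, E) 𝓘(ℝ, F) 2 f x) (hX : MDiffAt (T% X) x) (hY : MDiffAt (T% Y) x) :
    d% f x (mlieBracket 𝓘(ℝ, E) X Y x) =
      d% (fun y ↦ d% f y (Y y)) x (X x) - d% (fun y ↦ d% f y (X y)) x (Y x) := by
  set ψ := extChartAt 𝓘(ℝ, E) x with hψ
  have hI : Set.range 𝓘(ℝ, E) = Set.univ := by simp
  have hf' : ContDiffAt ℝ 2 (f ∘ ψ.symm) (ψ x) := by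
    have := (contMDiffAt_iff.1 hf).2
    rw [hI, contDiffWithinAt_univ] at this
    exact this
  have hev : ∀ᶠ y in nhds x, MDiffAt f y := by
    filter_upwards [(contMDiffAt_iff_contMDiffAt_nhds (by simp)).1 hf] with y hy
    exact hy.mdifferentiableAt (by simp)
  have hev' : ∀ᶠ z in nhds (ψ x), z ∈ ψ.target ∧ MDiffAt f (ψ.symm z) := by
    have h1 : ∀ᶠ z in nhds (ψ x), z ∈ ψ.target := extChartAt_target_mem_nhds (I := 𝓘(ℝ, E)) x
    refine h1.and ?_
    have := (continuousAt_extChartAt_symm (I := 𝓘(ℝ, E)) x).tendsto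
    rw [extChartAt_to_inv] at this
    exact this.eventually hev
  have key : ∀ Z : Π x : M, TangentSpace 𝓘(ℝ, E) x, MDiffAt (T% Z) x →
      ∀ v : TangentSpace 𝓘(ℝ, E) x, d% (fun y ↦ d% f y (Z y)) x v =
      fderiv ℝ (fun z ↦ fderiv ℝ (f ∘ ψ.symm) z (fieldInChart Z x z)) (ψ x) v := by
    intro Z hZ v
    have h1 : (fun y ↦ d% f y (Z y)) ∘ ψ.symm =ᶠ[nhds (ψ x)]
        (fun z ↦ fderiv ℝ (f ∘ ψ.symm) z (fieldInChart Z x z)) := by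
      filter_upwards [hev'] with z hz
      exact mvfderiv_symm_eq_fderiv hz.1 hz.2
    have h2 : DifferentiableAt ℝ (fun z ↦ fderiv ℝ (f ∘ ψ.symm) z (fieldInChart Z x z)) (ψ x) :=
      ((hf'.fderiv_right (m := 1) le_rfl).differentiableAt one_ne_zero).clm_apply
        (differentiableAt_fieldInChart hZ)
    -- Differentiability on the manifold is read off from the chart expression by composing back
    -- with `ψ`.
    have h3 : MDiffAt (fun y ↦ d% f y (Z y)) x := by
      have h4 : MDiffAt (fun y : M ↦ ((fun z ↦ d% f z (Z z)) ∘ ψ.symm) (ψ y)) x :=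
        (h2.congr_of_eventuallyEq h1).mdifferentiableAt.comp x
          (mdifferentiableAt_extChartAt (mem_chart_source E x))
      refine h4.congr_of_eventuallyEq ?_
      filter_upwards [extChartAt_source_mem_nhds (I := 𝓘(ℝ, E)) x] with y hy
      exact (congrArg (fun z ↦ d% f z (Z z)) (ψ.left_inv hy)).symm
    rw [mvfderiv_eq_fderiv h3, h1.fderiv_eq]
  have h := fderiv_apply_lieBracket hf' (by simp) (differentiableAt_fieldInChart hY)
    (differentiableAt_fieldInChart hX)
  rw [key X hX, key Y hY, mvfderiv_eq_fderiv (hf.mdifferentiableAt (by simp)),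
    mlieBracket_eq_lieBracket]
  rw [fieldInChart_self X, fieldInChart_self Y] at h
  exact h

end Commutator

/-! ### Calculus rules for derivatives of vector-valued functions -/

section Derivative

variable {E : Type*} [NormedAddCommGroup E] [NormedSpace ℝ E]
  {M : Type*} [TopologicalSpace M] [ChartedSpace E M]
  {F : Type*} [NormedAddCommGroup F] [NormedSpace ℝ F]

theorem mvfderiv_congr {f g : M → F} {x : M} (h : f =ᶠ[nhds x] g) :
    mvfderiv 𝓘(ℝ, E) f x = mvfderiv 𝓘(ℝ, E) g x :=
  h.mfderiv_eq (I := 𝓘(ℝ, E)) (I' := 𝓘(ℝ, F))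

theorem mdifferentiableAt_fun_sum {ι : Type*} (s : Finset ι) {f : ι → M → F} {x : M}
    (hf : ∀ i ∈ s, MDiffAt (f i) x) : MDiffAt (fun y ↦ ∑ i ∈ s, f i y) x := by
  classical
  induction s using Finset.induction_on with
  | empty => simpa using mdifferentiableAt_const
  | insert a s ha ih =>
    simp only [Finset.sum_insert ha]
    exact (hf a (Finset.mem_insert_self a s)).add
      (ih fun i hi ↦ hf i (Finset.mem_insert_of_mem hi))

theorem mvfderiv_fun_sum {ι : Type*} (s : Finset ι) {f : ι → M → F} {x : M}
    (hf : ∀ i ∈ s, MDiffAt (f i) x) :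
    mvfderiv 𝓘(ℝ, E) (fun y ↦ ∑ i ∈ s, f i y) x = ∑ i ∈ s, mvfderiv 𝓘(ℝ, E) (f i) x := by
  classical
  induction s using Finset.induction_on with
  | empty => simpa using mvfderiv_const (I := 𝓘(ℝ, E)) (0 : F) (x := x)
  | insert a s ha ih =>
    have hs : ∀ i ∈ s, MDiffAt (f i) x := fun i hi ↦ hf i (Finset.mem_insert_of_mem hi)
    simp only [Finset.sum_insert ha]
    rw [mvfderiv_fun_add (hf a (Finset.mem_insert_self a s)) (mdifferentiableAt_fun_sum s hs),
      ih hs]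

theorem mvfderiv_clm_comp {G : Type*} [NormedAddCommGroup G] [NormedSpace ℝ G] (L : F →L[ℝ] G)
    {f : M → F} {x : M} (hf : MDiffAt f x) (v : TangentSpace 𝓘(ℝ, E) x) :
    d% (fun y ↦ L (f y)) x v = L (d% f x v) := by
  have h := mfderiv_comp_apply (I := 𝓘(ℝ, E)) (I' := 𝓘(ℝ, F)) (I'' := 𝓘(ℝ, G)) x
    (L.differentiableAt.mdifferentiableAt) hf v
  refine Eq.trans h ?_
  rw [mfderiv_eq_fderiv, L.fderiv]
  rfl

end Derivative

/-! ### Coordinate fields and Christoffel symbols -/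

section CoordinateFields

variable {F : Type*} [NormedAddCommGroup F] [NormedSpace ℝ F]
  {N : Type*} [TopologicalSpace N] [ChartedSpace F N] [IsManifold 𝓘(ℝ, F) ∞ N]

theorem mvfderiv_extChartAt {p q : N} (hq : q ∈ (chartAt F p).source)
    (v : TangentSpace 𝓘(ℝ, F) q) :
    d% (extChartAt 𝓘(ℝ, F) p) q v = (trivializationAt F (TangentSpace 𝓘(ℝ, F)) p ⟨q, v⟩).2 := by
  have hq' : q ∈ (trivializationAt F (TangentSpace 𝓘(ℝ, F)) p).baseSet := by simpa using hq
  have h1 : d% (extChartAt 𝓘(ℝ, F) p) q v =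
      (trivializationAt F (TangentSpace 𝓘(ℝ, F)) p).continuousLinearMapAt ℝ q v := by
    rw [TangentBundle.continuousLinearMapAt_trivializationAt (I := 𝓘(ℝ, F)) hq]
    rfl
  rw [h1, Trivialization.continuousLinearMapAt_apply, Trivialization.linearMapAt_apply,
    if_pos hq']

theorem trivializationAt_extend {p q : N} (v : TangentSpace 𝓘(ℝ, F) p)
    (hq : q ∈ (chartAt F p).source) :
    (trivializationAt F (TangentSpace 𝓘(ℝ, F)) p ⟨q, extend F v q⟩).2 =
      (trivializationAt F (TangentSpace 𝓘(ℝ, F)) p ⟨p, v⟩).2 := by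
  have hq' : q ∈ (trivializationAt F (TangentSpace 𝓘(ℝ, F)) p).baseSet := by simpa using hq
  rw [extend, Trivialization.apply_mk_symm _ hq']

/-- Coordinate vector fields commute. -/
theorem mlieBracket_extend [CompleteSpace F] (p : N) (v w : TangentSpace 𝓘(ℝ, F) p) :
    mlieBracket 𝓘(ℝ, F) (extend F v) (extend F w) p = 0 := by
  have key : ∀ u : TangentSpace 𝓘(ℝ, F) p,
      d% (fun q ↦ d% (extChartAt 𝓘(ℝ, F) p) q (extend F u q)) p = 0 := by
    intro u
    have h : (fun q ↦ d% (extChartAt 𝓘(ℝ, F) p) q (extend F u q)) =ᶠ[nhds p]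
        fun _ ↦ (trivializationAt F (TangentSpace 𝓘(ℝ, F)) p ⟨p, u⟩).2 := by
      filter_upwards [chart_source_mem_nhds F p] with q hq
      rw [mvfderiv_extChartAt hq, trivializationAt_extend u hq]
    rw [mvfderiv_congr h, mvfderiv_const]
  -- The chart serves as test function: its derivative along a coordinate field is constant near
  -- `p`, so both second derivatives vanish, and its differential at `p` is the identity.
  have h := mvfderiv_mlieBracket (contMDiffAt_extChartAt (I := 𝓘(ℝ, F)) (x := p) (n := 2))
    (mdifferentiableAt_extend 𝓘(ℝ, F) F v) (mdifferentiableAt_extend 𝓘(ℝ, F) F w)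
  rw [key, key] at h
  have h1 : d% (extChartAt 𝓘(ℝ, F) p) p (mlieBracket 𝓘(ℝ, F) (extend F v) (extend F w) p) =
      mlieBracket 𝓘(ℝ, F) (extend F v) (extend F w) p :=
    congrArg (fun L : F →L[ℝ] F ↦ L _) (mfderiv_extChartAt_self (I := 𝓘(ℝ, F)) (x := p))
  rw [h1] at h
  exact h.trans (sub_self (0 : F))

theorem extend_eq_symmL {p q : N} (hq : q ∈ (chartAt F p).source) (v : TangentSpace 𝓘(ℝ, F) p) :
    (extend F v q : TangentSpace 𝓘(ℝ, F) q) =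
      (trivializationAt F (TangentSpace 𝓘(ℝ, F)) p).symmL ℝ q
        ((trivializationAt F (TangentSpace 𝓘(ℝ, F)) p).continuousLinearMapAt ℝ p v) := by
  have hq' : q ∈ (trivializationAt F (TangentSpace 𝓘(ℝ, F)) p).baseSet := by simpa using hq
  rw [Trivialization.continuousLinearMapAt_apply, Trivialization.linearMapAt_apply,
    if_pos (mem_baseSet_trivializationAt' p), Trivialization.symmL_apply _ hq', extend]

theorem extend_add {p : N} (v w : TangentSpace 𝓘(ℝ, F) p) :
    ∀ᶠ q in nhds p, (extend F (v + w) q : TangentSpace 𝓘(ℝ, F) q) =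
      ((extend F v + extend F w : Π q : N, TangentSpace 𝓘(ℝ, F) q)) q := by
  filter_upwards [chart_source_mem_nhds F p] with q hq
  rw [Pi.add_apply, extend_eq_symmL hq, extend_eq_symmL hq, extend_eq_symmL hq, map_add, map_add]

theorem extend_smul {p : N} (c : ℝ) (v : TangentSpace 𝓘(ℝ, F) p) :
    ∀ᶠ q in nhds p, (extend F (c • v) q : TangentSpace 𝓘(ℝ, F) q) =
      (c • extend F v : Π q : N, TangentSpace 𝓘(ℝ, F) q) q := by
  filter_upwards [chart_source_mem_nhds F p] with q hq
  rw [Pi.smul_apply, extend_eq_symmL hq, extend_eq_symmL hq, map_smul, map_smul]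

variable [RiemannianBundle (fun y : N ↦ TangentSpace 𝓘(ℝ, F) y)]
  [IsContMDiffRiemannianBundle 𝓘(ℝ, F) ∞ F (fun y : N ↦ TangentSpace 𝓘(ℝ, F) y)]
  [FiniteDimensional ℝ F]

variable (F) in
/-- The Christoffel map at `p` in the preferred chart: `v` is sent to the covariant derivative
at `p` of the field with constant components extending `v`. -/
noncomputable def christoffel (p : N) : TangentSpace 𝓘(ℝ, F) p →ₗ[ℝ]
    TangentSpace 𝓘(ℝ, F) p →L[ℝ] TangentSpace 𝓘(ℝ, F) p where
  toFun v := leviCivita F N (extend F v) p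
  map_add' v w := by
    rw [(leviCivita F N).isCovariantDerivativeOnUniv.congr_of_eventuallyEq
      (mdifferentiableAt_extend 𝓘(ℝ, F) F _) (mdifferentiableAt_add_section
        (mdifferentiableAt_extend 𝓘(ℝ, F) F v) (mdifferentiableAt_extend 𝓘(ℝ, F) F w))
      Filter.univ_mem (extend_add v w)]
    exact (leviCivita F N).isCovariantDerivativeOnUniv.add
      (mdifferentiableAt_extend 𝓘(ℝ, F) F v) (mdifferentiableAt_extend 𝓘(ℝ, F) F w)
  map_smul' c v := by
    rw [(leviCivita F N).isCovariantDerivativeOnUniv.congr_of_eventuallyEq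
      (mdifferentiableAt_extend 𝓘(ℝ, F) F _)
      ((mdifferentiableAt_const (c := c)).smul_section (mdifferentiableAt_extend 𝓘(ℝ, F) F v))
      Filter.univ_mem (extend_smul c v)]
    exact (leviCivita F N).isCovariantDerivativeOnUniv.smul_const c
      (mdifferentiableAt_extend 𝓘(ℝ, F) F v)

/-- The connection has no torsion and the extensions with constant components commute at `p`. -/
theorem christoffel_symm (p : N) (v w : TangentSpace 𝓘(ℝ, F) p) :
    christoffel F p v w = christoffel F p w v := by
  have := FiniteDimensional.complete ℝ F
  have h := leviCivita_torsionFree (mdifferentiableAt_extend 𝓘(ℝ, F) F w)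
    (mdifferentiableAt_extend 𝓘(ℝ, F) F v)
  rw [mlieBracket_extend, extend_apply_self, extend_apply_self, sub_eq_zero] at h
  exact h

end CoordinateFields

/-! ### Metric compatibility and vanishing torsion of the pullback connection -/

section PullbackConnection

variable {E : Type*} [NormedAddCommGroup E] [NormedSpace ℝ E]
  {M : Type*} [TopologicalSpace M] [ChartedSpace E M]
  {F : Type*} [NormedAddCommGroup F] [NormedSpace ℝ F] [FiniteDimensional ℝ F]
  {N : Type*} [TopologicalSpace N] [ChartedSpace F N] [IsManifold 𝓘(ℝ, F) ∞ N]
  [RiemannianBundle (fun y : N ↦ TangentSpace 𝓘(ℝ, F) y)]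
  [IsContMDiffRiemannianBundle 𝓘(ℝ, F) ∞ F (fun y : N ↦ TangentSpace 𝓘(ℝ, F) y)]

theorem pullbackNabla_eq (Ψ : M → N) (X : Π x : M, TangentSpace 𝓘(ℝ, E) x)
    (σ : Π x : M, TangentSpace 𝓘(ℝ, F) (Ψ x)) (x : M) :
    pullbackNabla F Ψ X σ x =
      (trivializationAt F (TangentSpace 𝓘(ℝ, F)) (Ψ x)).symmL ℝ (Ψ x)
        (d% (fun y : M ↦ (trivializationAt F (TangentSpace 𝓘(ℝ, F)) (Ψ x) ⟨Ψ y, σ y⟩).2) x (X x)) +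
      christoffel F (Ψ x) (σ x) (push F Ψ x (X x)) := rfl

theorem pullbackNabla_zero {Ψ : M → N} {x : M} (hΨ : ContinuousAt Ψ x)
    (X : Π x : M, TangentSpace 𝓘(ℝ, E) x) : pullbackNabla F Ψ X (fun _ ↦ 0) x = 0 := by
  have h : (fun y : M ↦ (trivializationAt F (TangentSpace 𝓘(ℝ, F)) (Ψ x)
      ⟨Ψ y, (0 : TangentSpace 𝓘(ℝ, F) (Ψ y))⟩).2) =ᶠ[nhds x] fun _ ↦ 0 := by
    filter_upwards [hΨ.preimage_mem_nhds
      ((trivializationAt F (TangentSpace 𝓘(ℝ, F)) (Ψ x)).open_baseSet.mem_nhds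
        (mem_baseSet_trivializationAt' (Ψ x)))] with y hy
    rw [Set.mem_preimage] at hy
    have := (trivializationAt F (TangentSpace 𝓘(ℝ, F)) (Ψ x)).linearMapAt_apply (R := ℝ)
      (0 : TangentSpace 𝓘(ℝ, F) (Ψ y))
    rw [map_zero, if_pos hy] at this
    exact this.symm
  rw [pullbackNabla_eq, mvfderiv_congr h, mvfderiv_const]
  simp

/-- The pullback connection is compatible with the metric of the target. -/
theorem pullbackNabla_metric {Ψ : M → N} {x : M} (hΨ : MDiffAt Ψ x)
    {σ τ : Π x : M, TangentSpace 𝓘(ℝ, F) (Ψ x)}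
    (hσ : MDiffAt (fun y ↦ (⟨Ψ y, σ y⟩ : TangentBundle 𝓘(ℝ, F) N)) x)
    (hτ : MDiffAt (fun y ↦ (⟨Ψ y, τ y⟩ : TangentBundle 𝓘(ℝ, F) N)) x)
    (X : Π x : M, TangentSpace 𝓘(ℝ, E) x) :
    d% (fun y ↦ inner ℝ (σ y) (τ y)) x (X x) =
      inner ℝ (pullbackNabla F Ψ X σ x) (τ x) + inner ℝ (σ x) (pullbackNabla F Ψ X τ x) := by
  set e := trivializationAt F (TangentSpace 𝓘(ℝ, F)) (Ψ x) with he
  let b := Module.finBasis ℝ F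
  let L : ∀ i, F →L[ℝ] ℝ := fun i ↦ LinearMap.toContinuousLinearMap (b.coord i)
  have hL : ∀ a : F, ∑ i, L i a • b i = a := fun a ↦ b.sum_repr a
  have hx : Ψ x ∈ e.baseSet := mem_baseSet_trivializationAt' (Ψ x)
  let v : ∀ i, TangentSpace 𝓘(ℝ, F) (Ψ x) := fun i ↦ e.symmL ℝ (Ψ x) (b i)
  have hv : ∀ a : F, e.symmL ℝ (Ψ x) a = ∑ i, L i a • v i := by
    intro a
    conv_lhs => rw [← hL a]
    simp [map_sum, map_smul, v]
  -- Expansion in the coordinate frame along Ψ. The inner product of `σ` and `τ` becomes a finite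
  -- sum of products of functions, and only the derivatives of the metric coefficients of `N`
  -- require metric compatibility.
  have hext : ∀ᶠ y in nhds x, ∀ u : TangentSpace 𝓘(ℝ, F) (Ψ y),
      u = ∑ i, L i (e ⟨Ψ y, u⟩).2 • (extend F (v i) (Ψ y) : TangentSpace 𝓘(ℝ, F) (Ψ y)) := by
    filter_upwards [hΨ.continuousAt.preimage_mem_nhds (chart_source_mem_nhds F (Ψ x))] with y hy u
    have hy' : Ψ y ∈ e.baseSet := by simpa [he] using hy
    have h1 : ∀ i, (extend F (v i) (Ψ y) : TangentSpace 𝓘(ℝ, F) (Ψ y)) = e.symmL ℝ (Ψ y) (b i) := by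
      intro i
      rw [extend_eq_symmL hy, e.continuousLinearMapAt_symmL hx]
    simp only [h1, ← map_smul, ← map_sum, hL]
    rw [e.symmL_apply hy', e.symm_apply_apply_mk hy']
  have hs : MDiffAt (fun y : M ↦ (e ⟨Ψ y, σ y⟩).2) x := ((mdifferentiableAt_totalSpace _ _).1 hσ).2
  have ht : MDiffAt (fun y : M ↦ (e ⟨Ψ y, τ y⟩).2) x := ((mdifferentiableAt_totalSpace _ _).1 hτ).2
  let s : ∀ i, M → ℝ := fun i y ↦ L i (e ⟨Ψ y, σ y⟩).2
  let t : ∀ i, M → ℝ := fun i y ↦ L i (e ⟨Ψ y, τ y⟩).2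
  let G : ∀ i j, N → ℝ := fun i j q ↦ inner ℝ (extend F (v i) q : TangentSpace 𝓘(ℝ, F) q)
    (extend F (v j) q)
  have hs' : ∀ i, MDiffAt (s i) x := fun i ↦ (L i).differentiableAt.mdifferentiableAt.comp x hs
  have ht' : ∀ i, MDiffAt (t i) x := fun i ↦ (L i).differentiableAt.mdifferentiableAt.comp x ht
  have hG : ∀ i j, MDiffAt (G i j) (Ψ x) := fun i j ↦ mdifferentiableAt_inner
    (mdifferentiableAt_extend 𝓘(ℝ, F) F _) (mdifferentiableAt_extend 𝓘(ℝ, F) F _)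
  have hGΨ : ∀ i j, MDiffAt (fun y ↦ G i j (Ψ y)) x := fun i j ↦ (hG i j).comp x hΨ
  have hsum : (fun y ↦ inner ℝ (σ y) (τ y)) =ᶠ[nhds x]
      fun y ↦ ∑ j, ∑ i, t j y * (s i y * G i j (Ψ y)) := by
    filter_upwards [hext] with y hy
    conv_lhs => rw [hy (σ y), hy (τ y)]
    simp only [sum_inner, inner_sum, real_inner_smul_left, real_inner_smul_right]
    rfl
  have hmul : ∀ i j, MDiffAt (fun y ↦ t j y * (s i y * G i j (Ψ y))) x :=
    fun i j ↦ (ht' j).mul ((hs' i).mul (hGΨ i j))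
  have hds : ∀ i, d% (s i) x (X x) = L i (d% (fun y : M ↦ (e ⟨Ψ y, σ y⟩).2) x (X x)) :=
    fun i ↦ mvfderiv_clm_comp (L i) hs _
  have hdt : ∀ i, d% (t i) x (X x) = L i (d% (fun y : M ↦ (e ⟨Ψ y, τ y⟩).2) x (X x)) :=
    fun i ↦ mvfderiv_clm_comp (L i) ht _
  have hdG : ∀ i j, d% (fun y ↦ G i j (Ψ y)) x (X x) =
      inner ℝ (christoffel F (Ψ x) (v i) (push F Ψ x (X x))) (v j) +
      inner ℝ (v i) (christoffel F (Ψ x) (v j) (push F Ψ x (X x))) := by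
    intro i j
    have h := leviCivita_metric (mdifferentiableAt_extend 𝓘(ℝ, F) F (v i))
      (mdifferentiableAt_extend 𝓘(ℝ, F) F (v j)) (push F Ψ x (X x))
    rw [extend_apply_self, extend_apply_self] at h
    exact (mvfderiv_comp_apply x (hG i j) hΨ (X x)).trans h
  have hσx : σ x = ∑ i, s i x • v i := by simpa using hext.self_of_nhds (σ x)
  have hτx : τ x = ∑ i, t i x • v i := by simpa using hext.self_of_nhds (τ x)
  have hGx : ∀ i j, G i j (Ψ x) = inner ℝ (v i) (v j) := fun i j ↦ by simp [G]
  have hprod : ∀ i j, d% (fun y ↦ t j y * (s i y * G i j (Ψ y))) x (X x) =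
      t j x * (s i x * d% (fun y ↦ G i j (Ψ y)) x (X x) + G i j (Ψ x) * d% (s i) x (X x)) +
        s i x * G i j (Ψ x) * d% (t j) x (X x) := by
    intro i j
    have h : MDiffAt (fun y ↦ s i y * G i j (Ψ y)) x := (hs' i).mul (hGΨ i j)
    rw [mvfderiv_fun_mul (ht' j) h, mvfderiv_fun_mul (hs' i) (hGΨ i j)]
    simp
    ring
  rw [mvfderiv_congr hsum,
    mvfderiv_fun_sum _ fun j _ ↦ mdifferentiableAt_fun_sum _ fun i _ ↦ hmul i j,
    sum_apply]
  simp only [mvfderiv_fun_sum _ fun i _ ↦ hmul i _, sum_apply, hprod, hdG,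
    hGx, hds, hdt]
  have hP : ∀ ρ : Π x : M, TangentSpace 𝓘(ℝ, F) (Ψ x), pullbackNabla F Ψ X ρ x =
      ∑ i, L i (d% (fun y : M ↦ (e ⟨Ψ y, ρ y⟩).2) x (X x)) • v i +
        christoffel F (Ψ x) (ρ x) (push F Ψ x (X x)) := fun ρ ↦ by rw [← hv, pullbackNabla_eq]
  rw [hP, hP, hσx, hτx]
  simp only [map_sum, map_smul, sum_apply, smul_apply,
    inner_add_left, inner_add_right,
    sum_inner, inner_sum, real_inner_smul_left, real_inner_smul_right, ← Finset.sum_add_distrib]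
  refine Finset.sum_congr rfl fun j _ ↦ Finset.sum_congr rfl fun i _ ↦ ?_
  ring

variable [IsManifold 𝓘(ℝ, E) ∞ M] [FiniteDimensional ℝ E]

/-- The pullback connection has no torsion. -/
theorem pullbackNabla_torsionFree {Ψ : M → N} {x : M} (hΨ : ContMDiffAt 𝓘(ℝ, E) 𝓘(ℝ, F) 2 Ψ x)
    {X Y : Π x : M, TangentSpace 𝓘(ℝ, E) x} (hX : MDiffAt (T% X) x) (hY : MDiffAt (T% Y) x) :
    pullbackNabla F Ψ X (fun y ↦ push F Ψ y (Y y)) x -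
      pullbackNabla F Ψ Y (fun y ↦ push F Ψ y (X y)) x =
        push F Ψ x (mlieBracket 𝓘(ℝ, E) X Y x) := by
  have := FiniteDimensional.complete ℝ E
  have hev : ∀ᶠ y in nhds x, MDiffAt Ψ y ∧ Ψ y ∈ (chartAt F (Ψ x)).source := by
    refine .and ?_ (hΨ.continuousAt.preimage_mem_nhds (chart_source_mem_nhds F (Ψ x)))
    filter_upwards [(contMDiffAt_iff_contMDiffAt_nhds (by simp)).1 hΨ] with y hy
    exact hy.mdifferentiableAt (by simp)
  set f : M → F := fun y ↦ extChartAt 𝓘(ℝ, F) (Ψ x) (Ψ y) with hf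
  have hpush : ∀ᶠ y in nhds x, ∀ v : TangentSpace 𝓘(ℝ, E) y,
      (trivializationAt F (TangentSpace 𝓘(ℝ, F)) (Ψ x) ⟨Ψ y, push F Ψ y v⟩).2 = d% f y v := by
    filter_upwards [hev] with y hy v
    rw [← mvfderiv_extChartAt hy.2]
    exact (mfderiv_comp_apply y (mdifferentiableAt_extChartAt hy.2) hy.1 v).symm
  have hcoord : ∀ Z : Π x : M, TangentSpace 𝓘(ℝ, E) x,
      d% (fun y : M ↦ (trivializationAt F (TangentSpace 𝓘(ℝ, F)) (Ψ x)
        ⟨Ψ y, push F Ψ y (Z y)⟩).2) x = d% (fun y ↦ d% f y (Z y)) x := by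
    intro Z
    refine mvfderiv_congr ?_
    filter_upwards [hpush] with y hy
    exact hy _
  have hf2 : ContMDiffAt 𝓘(ℝ, E) 𝓘(ℝ, F) 2 f x :=
    (contMDiffAt_extChartAt (I := 𝓘(ℝ, F)) (x := Ψ x) (n := 2)).comp x hΨ
  -- The Christoffel terms cancel by symmetry. What remains is the commutator of `X` and `Y` acting
  -- on `f`, the coordinate expression of Ψ.
  rw [pullbackNabla_eq, pullbackNabla_eq, hcoord, hcoord, christoffel_symm, add_sub_add_right_eq_sub,
    ← map_sub, ← mvfderiv_mlieBracket hf2 hX hY, ← hpush.self_of_nhds,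
    Trivialization.symmL_apply _ (mem_baseSet_trivializationAt' (Ψ x)),
    Trivialization.symm_apply_apply_mk _ (mem_baseSet_trivializationAt' (Ψ x))]

end PullbackConnection

/-! ### Smooth vector fields and smoothness from inner products -/

section Smoothness

variable {E : Type*} [NormedAddCommGroup E] [NormedSpace ℝ E]
  {M : Type*} [TopologicalSpace M] [ChartedSpace E M]

theorem contMDiffAt_det {k : ℕ} {A : M → Matrix (Fin k) (Fin k) ℝ} {x : M}
    (hA : ∀ i j, CMDiffAt ∞ (fun y ↦ A y i j) x) : CMDiffAt ∞ (fun y ↦ (A y).det) x := by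
  simp only [Matrix.det_apply, zsmul_eq_mul, Units.smul_def]
  exact contMDiffAt_finsetSum fun σ _ ↦
    contMDiffAt_const.mul (contMDiffAt_finsetProd fun i _ ↦ hA _ _)

variable [IsManifold 𝓘(ℝ, E) ∞ M]

/-- Every tangent vector is the value of a smooth vector field. -/
theorem exists_smoothField [FiniteDimensional ℝ E] [T2Space M] {x : M}
    (v : TangentSpace 𝓘(ℝ, E) x) :
    ∃ X : Π x : M, TangentSpace 𝓘(ℝ, E) x, IsSmoothField X ∧ X x = v := by
  obtain ⟨s, hs, hsv⟩ := exists_contMDiffOn_extend (k := ∞) 𝓘(ℝ, E) E v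
  obtain ⟨u, hus, hu, hxu⟩ := mem_nhds_iff.1 hs
  obtain ⟨f, -, hf⟩ := (SmoothBumpFunction.nhds_basis_tsupport (I := 𝓘(ℝ, E)) x).mem_iff.1
    (hu.mem_nhds hxu)
  refine ⟨(f : M → ℝ) • extend E v, ?_, ?_⟩
  · exact ContMDiffOn.smul_section_of_tsupport f.contMDiff.contMDiffOn hu hf (hsv.mono hus)
  · simp

theorem IsSmoothField.mdiff {X : Π x : M, TangentSpace 𝓘(ℝ, E) x} (hX : IsSmoothField X) (x : M) :
    MDiffAt (T% X) x := (hX x).mdifferentiableAt (by simp)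

theorem IsSmoothField.sub {X Y : Π x : M, TangentSpace 𝓘(ℝ, E) x} (hX : IsSmoothField X)
    (hY : IsSmoothField Y) : IsSmoothField (fun x ↦ X x - Y x) := ContMDiff.sub_section hX hY

theorem IsSmoothField.const_smul {X : Π x : M, TangentSpace 𝓘(ℝ, E) x} (c : ℝ)
    (hX : IsSmoothField X) : IsSmoothField (fun x ↦ c • X x) :=
  ContMDiff.const_smul_section (a := c) hX

theorem isSmoothField_mlieBracket [CompleteSpace E] {X Y : Π x : M, TangentSpace 𝓘(ℝ, E) x}
    (hX : IsSmoothField X) (hY : IsSmoothField Y) :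
    IsSmoothField (mlieBracket 𝓘(ℝ, E) X Y) := by
  have h2 : minSmoothness ℝ 2 ≤ (∞ : WithTop ℕ∞) := by
    rw [minSmoothness_of_isRCLikeNormedField]
    exact WithTop.coe_le_coe.2 le_top
  have : IsManifold 𝓘(ℝ, E) (minSmoothness ℝ 2) M := IsManifold.of_le h2
  have : IsManifold 𝓘(ℝ, E) ((⊤ : ℕ∞) + 1) M := by simpa using ‹IsManifold 𝓘(ℝ, E) ∞ M›
  exact ContDiff.mlieBracket_vectorField (m := ⊤) (n := ⊤) hX hY (by simp)

theorem IsSmoothField.clm_apply {φ : Π x : M, TangentSpace 𝓘(ℝ, E) x →L[ℝ] TangentSpace 𝓘(ℝ, E) x}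
    (hφ : ContMDiff 𝓘(ℝ, E) (𝓘(ℝ, E).prod 𝓘(ℝ, E →L[ℝ] E)) ∞
      (fun x ↦ TotalSpace.mk' (E →L[ℝ] E)
        (E := fun x : M ↦ TangentSpace 𝓘(ℝ, E) x →L[ℝ] TangentSpace 𝓘(ℝ, E) x) x (φ x)))
    {X : Π x : M, TangentSpace 𝓘(ℝ, E) x} (hX : IsSmoothField X) :
    IsSmoothField (fun x ↦ φ x (X x)) :=
  ContMDiff.clm_bundle_apply (F₁ := E) (F₂ := E) (b := fun x : M ↦ x) hφ hX

/-- The Jacobi identity for smooth vector fields. -/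
theorem mlieBracket_jacobi [CompleteSpace E] {X Y Z : Π x : M, TangentSpace 𝓘(ℝ, E) x}
    (hX : IsSmoothField X) (hY : IsSmoothField Y) (hZ : IsSmoothField Z) (x : M) :
    mlieBracket 𝓘(ℝ, E) X (mlieBracket 𝓘(ℝ, E) Y Z) x =
      mlieBracket 𝓘(ℝ, E) (mlieBracket 𝓘(ℝ, E) X Y) Z x +
        mlieBracket 𝓘(ℝ, E) Y (mlieBracket 𝓘(ℝ, E) X Z) x := by
  have h3 : minSmoothness ℝ 3 ≤ (∞ : WithTop ℕ∞) := by
    rw [minSmoothness_of_isRCLikeNormedField]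
    exact WithTop.coe_le_coe.2 le_top
  have h2 : minSmoothness ℝ 2 ≤ (∞ : WithTop ℕ∞) := by
    rw [minSmoothness_of_isRCLikeNormedField]
    exact WithTop.coe_le_coe.2 le_top
  have : IsManifold 𝓘(ℝ, E) (minSmoothness ℝ 3) M := IsManifold.of_le h3
  exact leibniz_identity_mlieBracket_apply ((hX x).of_le h2) ((hY x).of_le h2) ((hZ x).of_le h2)

variable [RiemannianBundle (fun x : M ↦ TangentSpace 𝓘(ℝ, E) x)]
  [IsContMDiffRiemannianBundle 𝓘(ℝ, E) ∞ E (fun x : M ↦ TangentSpace 𝓘(ℝ, E) x)]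

theorem IsSmoothField.contMDiff_inner {X Y : Π x : M, TangentSpace 𝓘(ℝ, E) x} (hX : IsSmoothField X)
    (hY : IsSmoothField Y) : CMDiff ∞ (fun x ↦ inner ℝ (X x) (Y x)) :=
  ContMDiff.inner_bundle (E := fun x : M ↦ TangentSpace 𝓘(ℝ, E) x) hX hY

/-- A section of the span of a smooth frame is smooth as soon as its inner products with the
frame are. -/
theorem contMDiffAt_of_inner_frame {k : ℕ} {e : Fin k → Π y : M, TangentSpace 𝓘(ℝ, E) y} {x : M}
    (he : ∀ i, CMDiffAt ∞ (T% (e i)) x)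
    (hli : ∀ᶠ y in nhds x, LinearIndependent ℝ (fun i ↦ e i y))
    {Z : Π y : M, TangentSpace 𝓘(ℝ, E) y}
    (hZ : ∀ᶠ y in nhds x, Z y ∈ Submodule.span ℝ (Set.range fun i ↦ e i y))
    (hZe : ∀ i, CMDiffAt ∞ (fun y ↦ inner ℝ (e i y) (Z y)) x) :
    CMDiffAt ∞ (T% Z) x := by
  -- The coefficients of `Z` in the frame solve a linear system with the Gram matrix. Cramer's rule
  -- exhibits them as quotients of smooth functions, the denominator being nonzero by linear
  -- independence.
  let G : M → Matrix (Fin k) (Fin k) ℝ := fun y ↦ Matrix.gram ℝ (fun i ↦ e i y)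
  let b : M → Fin k → ℝ := fun y i ↦ inner ℝ (e i y) (Z y)
  have hG : ∀ i j, CMDiffAt ∞ (fun y ↦ G y i j) x := fun i j ↦
    ContMDiffAt.inner_bundle (E := fun x : M ↦ TangentSpace 𝓘(ℝ, E) x) (he i) (he j)
  let c : Fin k → M → ℝ := fun j y ↦ ((G y).updateCol j (b y)).det / (G y).det
  have hdet : (G x).det ≠ 0 := Matrix.det_gram_ne_zero_iff_linearIndependent.2 hli.self_of_nhds
  have hc : ∀ j, CMDiffAt ∞ (c j) x := by
    intro j
    refine ContMDiffAt.div₀ (contMDiffAt_det fun i l ↦ ?_) (contMDiffAt_det hG) hdet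
    by_cases hl : l = j
    · subst hl
      simpa using hZe i
    · simpa [Matrix.updateCol_ne hl] using hG i l
  have hsum : ContMDiffAt 𝓘(ℝ, E) 𝓘(ℝ, E).tangent ∞
      (fun y ↦ (⟨y, ∑ j, c j y • e j y⟩ : TangentBundle 𝓘(ℝ, E) M)) x :=
    ContMDiffAt.sum_section fun j _ ↦ (hc j).smul_section (he j)
  refine hsum.congr_of_eventuallyEq ?_
  filter_upwards [hli, hZ] with y hy hZy
  obtain ⟨a, ha⟩ := (Submodule.mem_span_range_iff_exists_fun ℝ).1 hZy
  have hb : b y = (G y).mulVec a := by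
    funext i
    simp only [b, G, ← ha, Matrix.mulVec, dotProduct, inner_sum, real_inner_smul_right,
      Matrix.gram_apply]
    exact Finset.sum_congr rfl fun j _ ↦ mul_comm _ _
  have hd : (G y).det ≠ 0 := Matrix.det_gram_ne_zero_iff_linearIndependent.2 hy
  have hcr : (G y).cramer (b y) = (G y).det • a := by
    rw [hb, Matrix.cramer_eq_adjugate_mulVec, Matrix.mulVec_mulVec, Matrix.adjugate_mul,
      Matrix.smul_mulVec, Matrix.one_mulVec]
  have hca : ∀ j, c j y = a j := by
    intro j
    have := congrFun hcr j
    rw [Matrix.cramer_apply, Pi.smul_apply, smul_eq_mul] at this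
    simp only [c, this]
    field_simp
  simp only [hca, ha]

end Smoothness

/-! ### Smoothness of the dilation and of the projections; extension of vectors to sections -/

section Projections

variable {E : Type*} [NormedAddCommGroup E] [NormedSpace ℝ E] [FiniteDimensional ℝ E]
  {M : Type*} [TopologicalSpace M] [ChartedSpace E M] [IsManifold 𝓘(ℝ, E) ∞ M]
  [RiemannianBundle (fun x : M ↦ TangentSpace 𝓘(ℝ, E) x)]
  {F : Type*} [NormedAddCommGroup F] [NormedSpace ℝ F] [FiniteDimensional ℝ F]
  {N : Type*} [TopologicalSpace N] [ChartedSpace F N] [IsManifold 𝓘(ℝ, F) ∞ N]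
  [RiemannianBundle (fun y : N ↦ TangentSpace 𝓘(ℝ, F) y)]
  {φ : Π x : M, TangentSpace 𝓘(ℝ, E) x →L[ℝ] TangentSpace 𝓘(ℝ, E) x}
  {ζ : Π x : M, TangentSpace 𝓘(ℝ, E) x} {η : Π x : M, TangentSpace 𝓘(ℝ, E) x →L[ℝ] ℝ}
  {Ψ : M → N} {dil : M → ℝ} {D₁ : Π x : M, Submodule ℝ (TangentSpace 𝓘(ℝ, E) x)}

theorem push_hproj (x : M) (u : TangentSpace 𝓘(ℝ, E) x) :
    push F Ψ x (hproj F Ψ x u) = push F Ψ x u := by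
  have h : u - hproj F Ψ x u ∈ (horizontal F Ψ x)ᗮ := Submodule.sub_starProjection_mem_orthogonal u
  rw [horizontal, Submodule.orthogonal_orthogonal] at h
  have h' : push F Ψ x (u - hproj F Ψ x u) = 0 := h
  rw [map_sub, sub_eq_zero] at h'
  exact h'.symm

theorem hproj_mem (x : M) (u : TangentSpace 𝓘(ℝ, E) x) : hproj F Ψ x u ∈ horizontal F Ψ x :=
  Submodule.starProjection_apply_mem _ _

theorem vproj_mem (x : M) (u : TangentSpace 𝓘(ℝ, E) x) : vproj F Ψ x u ∈ vertical F Ψ x :=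
  Submodule.starProjection_apply_mem _ _

theorem inner_vertical_horizontal {x : M} {u v : TangentSpace 𝓘(ℝ, E) x}
    (hu : u ∈ vertical F Ψ x) (hv : v ∈ horizontal F Ψ x) : inner ℝ u v = 0 :=
  Submodule.inner_right_of_mem_orthogonal hu hv

theorem inner_horizontal_vertical {x : M} {u v : TangentSpace 𝓘(ℝ, E) x}
    (hu : u ∈ horizontal F Ψ x) (hv : v ∈ vertical F Ψ x) : inner ℝ u v = 0 :=
  Submodule.inner_left_of_mem_orthogonal hv hu

theorem vproj_add_hproj (x : M) (u : TangentSpace 𝓘(ℝ, E) x) :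
    vproj F Ψ x u + hproj F Ψ x u = u :=
  Submodule.starProjection_add_starProjection_orthogonal u

theorem inner_hproj_left {x : M} (u : TangentSpace 𝓘(ℝ, E) x) {v : TangentSpace 𝓘(ℝ, E) x}
    (hv : v ∈ horizontal F Ψ x) : inner ℝ (hproj F Ψ x u) v = inner ℝ u v := by
  conv_rhs => rw [← vproj_add_hproj (F := F) (Ψ := Ψ) x u]
  rw [inner_add_left, inner_vertical_horizontal (vproj_mem x u) hv, zero_add]

/-- Only one argument has to be horizontal, because Ψ_* kills the vertical part of the other and
that part is orthogonal to `v`. -/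
theorem IsConformalSubmersion.inner_push (h : IsConformalSubmersion E F Ψ dil) {x : M}
    (u : TangentSpace 𝓘(ℝ, E) x) {v : TangentSpace 𝓘(ℝ, E) x} (hv : v ∈ horizontal F Ψ x) :
    inner ℝ (push F Ψ x u) (push F Ψ x v) = dil x ^ 2 * inner ℝ u v := by
  rw [← push_hproj x u, h.conformal x _ (hproj_mem x u) _ hv, inner_hproj_left u hv]

/-- The projection to `D₂` is the difference of the projections to `ker Ψ_*` and to `D₁`. -/
theorem starProjection_antiInvariant (hD : ∀ x, D₁ x ≤ vertical F Ψ x) (x : M)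
    (u : TangentSpace 𝓘(ℝ, E) x) :
    (antiInvariant F Ψ D₁ x).starProjection u =
      u - hproj F Ψ x u - (D₁ x).starProjection u := by
  have h1 : u - hproj F Ψ x u = vproj F Ψ x u := by
    rw [sub_eq_iff_eq_add, vproj_add_hproj]
  refine Submodule.eq_starProjection_of_mem_of_inner_eq_zero ?_ ?_
  · refine ⟨?_, ?_⟩
    · rw [h1]
      exact sub_mem (vproj_mem x u) (hD x (Submodule.starProjection_apply_mem _ _))
    · have h2 : u - hproj F Ψ x u - (D₁ x).starProjection u =
          (u - (D₁ x).starProjection u) - hproj F Ψ x u := by abel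
      rw [h2]
      exact sub_mem (Submodule.sub_starProjection_mem_orthogonal u)
        (Submodule.orthogonal_le (hD x) (hproj_mem x u))
  · intro w hw
    have h2 : u - (u - hproj F Ψ x u - (D₁ x).starProjection u) =
        hproj F Ψ x u + (D₁ x).starProjection u := by abel
    rw [h2, inner_add_left, inner_horizontal_vertical (hproj_mem x u) hw.1,
      Submodule.inner_right_of_mem_orthogonal (Submodule.starProjection_apply_mem _ _) hw.2,
      add_zero]

variable [IsContMDiffRiemannianBundle 𝓘(ℝ, E) ∞ E (fun x : M ↦ TangentSpace 𝓘(ℝ, E) x)]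

theorem IsSmoothDistribution.isSmoothField_starProjection (hD : IsSmoothDistribution D₁)
    {X : Π x : M, TangentSpace 𝓘(ℝ, E) x} (hX : IsSmoothField X) :
    IsSmoothField (fun x ↦ (D₁ x).starProjection (X x)) := by
  intro x
  obtain ⟨U, k, e, hU, hxU, he, hUe⟩ := hD x
  refine contMDiffAt_of_inner_frame (e := e) (fun i ↦ (he i).contMDiffAt (hU.mem_nhds hxU)) ?_ ?_ ?_
  · filter_upwards [hU.mem_nhds hxU] with y hy using (hUe y hy).1
  · filter_upwards [hU.mem_nhds hxU] with y hy
    rw [(hUe y hy).2]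
    exact Submodule.starProjection_apply_mem _ _
  · intro i
    have h : CMDiffAt ∞ (fun y ↦ inner ℝ (e i y) (X y)) x :=
      ContMDiffAt.inner_bundle (E := fun x : M ↦ TangentSpace 𝓘(ℝ, E) x)
        ((he i).contMDiffAt (hU.mem_nhds hxU)) (hX x)
    refine h.congr_of_eventuallyEq ?_
    filter_upwards [hU.mem_nhds hxU] with y hy
    have hey : e i y ∈ D₁ y := by
      rw [← (hUe y hy).2]
      exact Submodule.subset_span ⟨i, rfl⟩
    rw [← Submodule.inner_starProjection_left_eq_right, Submodule.starProjection_eq_self_iff.2 hey]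

variable [IsContMDiffRiemannianBundle 𝓘(ℝ, F) ∞ F (fun y : N ↦ TangentSpace 𝓘(ℝ, F) y)]

theorem contMDiffAt_push (hΨ : ContMDiff 𝓘(ℝ, E) 𝓘(ℝ, F) ∞ Ψ) {X : Π x : M, TangentSpace 𝓘(ℝ, E) x}
    {x : M} (hX : CMDiffAt ∞ (T% X) x) :
    CMDiffAt ∞ (fun y ↦ (⟨Ψ y, push F Ψ y (X y)⟩ : TangentBundle 𝓘(ℝ, F) N)) x :=
  ((hΨ.contMDiff_tangentMap (m := ∞) (by simp)).contMDiffAt).comp x hX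

theorem contMDiffAt_inner_push (hΨ : ContMDiff 𝓘(ℝ, E) 𝓘(ℝ, F) ∞ Ψ)
    {X Y : Π x : M, TangentSpace 𝓘(ℝ, E) x} {x : M} (hX : CMDiffAt ∞ (T% X) x)
    (hY : CMDiffAt ∞ (T% Y) x) :
    CMDiffAt ∞ (fun y ↦ inner ℝ (push F Ψ y (X y)) (push F Ψ y (Y y))) x :=
  ContMDiffAt.inner_bundle (E := fun y : N ↦ TangentSpace 𝓘(ℝ, F) y)
    (contMDiffAt_push hΨ hX) (contMDiffAt_push hΨ hY)

/-- The square of the dilation is the squared length of `Ψ_* ζ`. -/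
theorem dil_sq (hM : IsAlmostContactMetric φ ζ η) (hΨ : IsSicReebPerpSubmersion F φ ζ Ψ dil D₁)
    (x : M) : dil x ^ 2 = inner ℝ (push F Ψ x (ζ x)) (push F Ψ x (ζ x)) := by
  rw [hΨ.inner_push _ (hΨ.reeb_horizontal x), hM.inner_reeb, hM.eta_reeb, mul_one]

/-- Smoothness of λ² is not part of the definition of the submersion; it follows because ζ is a
smooth horizontal unit field. -/
theorem contMDiff_dil_sq (hM : IsAlmostContactMetric φ ζ η)
    (hΨ : IsSicReebPerpSubmersion F φ ζ Ψ dil D₁) : CMDiff ∞ (fun x ↦ dil x ^ 2) := by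
  simp only [dil_sq hM hΨ]
  exact fun x ↦ contMDiffAt_inner_push hΨ.smooth (hM.smooth_reeb x) (hM.smooth_reeb x)

theorem isSmoothField_hproj (hM : IsAlmostContactMetric φ ζ η)
    (hΨ : IsSicReebPerpSubmersion F φ ζ Ψ dil D₁) {X : Π x : M, TangentSpace 𝓘(ℝ, E) x}
    (hX : IsSmoothField X) : IsSmoothField (fun x ↦ hproj F Ψ x (X x)) := by
  intro x
  let b := Module.finBasis ℝ E
  let t := trivializationAt E (TangentSpace 𝓘(ℝ, E)) x
  have hf := t.isLocalFrameOn_localFrame_baseSet (n := ∞) 𝓘(ℝ, E) b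
  have ht : t.baseSet ∈ nhds x := t.open_baseSet.mem_nhds (mem_baseSet_trivializationAt' x)
  refine contMDiffAt_of_inner_frame (e := t.localFrame b)
    (fun i ↦ hf.contMDiffAt t.open_baseSet (mem_baseSet_trivializationAt' x) i) ?_ ?_ ?_
  · filter_upwards [ht] with y hy using hf.linearIndependent hy
  · filter_upwards [ht] with y hy using hf.generating hy trivial
  · intro i
    -- Conformality expresses the inner product of the horizontal part of `X` with any frame vector
    -- through Ψ_* and λ², so no smooth frame of the horizontal distribution is needed.
    have h : CMDiffAt ∞ (fun y ↦ inner ℝ (push F Ψ y (t.localFrame b i y)) (push F Ψ y (X y)) /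
        dil y ^ 2) x :=
      (contMDiffAt_inner_push hΨ.smooth
        (hf.contMDiffAt t.open_baseSet (mem_baseSet_trivializationAt' x) i) (hX x)).div₀
        (contMDiff_dil_sq hM hΨ x) (pow_ne_zero 2 (hΨ.dil_pos x).ne')
    refine h.congr_of_eventuallyEq (.of_forall fun y ↦ ?_)
    have hd : dil y ^ 2 ≠ 0 := pow_ne_zero 2 (hΨ.dil_pos y).ne'
    beta_reduce
    rw [← push_hproj y (X y), hΨ.inner_push _ (hproj_mem y _), mul_div_cancel_left₀ _ hd]

theorem isSmoothField_antiInvariant (hM : IsAlmostContactMetric φ ζ η)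
    (hΨ : IsSicReebPerpSubmersion F φ ζ Ψ dil D₁) {X : Π x : M, TangentSpace 𝓘(ℝ, E) x}
    (hX : IsSmoothField X) :
    IsSmoothField (fun x ↦ (antiInvariant F Ψ D₁ x).starProjection (X x)) := by
  simp only [starProjection_antiInvariant hΨ.D₁_le]
  exact (hX.sub (isSmoothField_hproj hM hΨ hX)).sub
    (hΨ.smooth_D₁.isSmoothField_starProjection hX)

variable [T2Space M]

theorem exists_section_D₁ (hΨ : IsSicReebPerpSubmersion F φ ζ Ψ dil D₁) {x : M}
    {v : TangentSpace 𝓘(ℝ, E) x} (hv : v ∈ D₁ x) : ∃ X, IsSection D₁ X ∧ X x = v := by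
  obtain ⟨X, hX, hXv⟩ := exists_smoothField v
  refine ⟨_, ⟨hΨ.smooth_D₁.isSmoothField_starProjection hX,
    fun y ↦ Submodule.starProjection_apply_mem _ _⟩, ?_⟩
  simp only [hXv]
  exact Submodule.starProjection_eq_self_iff.2 hv

theorem exists_section_antiInvariant (hM : IsAlmostContactMetric φ ζ η)
    (hΨ : IsSicReebPerpSubmersion F φ ζ Ψ dil D₁) {x : M}
    {v : TangentSpace 𝓘(ℝ, E) x} (hv : v ∈ antiInvariant F Ψ D₁ x) :
    ∃ X, IsSection (antiInvariant F Ψ D₁) X ∧ X x = v := by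
  obtain ⟨X, hX, hXv⟩ := exists_smoothField v
  refine ⟨_, ⟨isSmoothField_antiInvariant hM hΨ hX,
    fun y ↦ Submodule.starProjection_apply_mem _ _⟩, ?_⟩
  simp only [hXv]
  exact Submodule.starProjection_eq_self_iff.2 hv

theorem exists_section_horizontal (hM : IsAlmostContactMetric φ ζ η)
    (hΨ : IsSicReebPerpSubmersion F φ ζ Ψ dil D₁) {x : M}
    {v : TangentSpace 𝓘(ℝ, E) x} (hv : v ∈ horizontal F Ψ x) :
    ∃ X, IsSection (horizontal F Ψ) X ∧ X x = v := by
  obtain ⟨X, hX, hXv⟩ := exists_smoothField v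
  refine ⟨_, ⟨isSmoothField_hproj hM hΨ hX, fun y ↦ hproj_mem y _⟩, ?_⟩
  simp only [hXv]
  exact Submodule.starProjection_eq_self_iff.2 hv

theorem exists_section_vertical (hM : IsAlmostContactMetric φ ζ η)
    (hΨ : IsSicReebPerpSubmersion F φ ζ Ψ dil D₁) {x : M}
    {v : TangentSpace 𝓘(ℝ, E) x} (hv : v ∈ vertical F Ψ x) :
    ∃ X, IsSection (vertical F Ψ) X ∧ X x = v := by
  obtain ⟨X, hX, hXv⟩ := exists_smoothField v
  have h : ∀ y, X y - hproj F Ψ y (X y) = vproj F Ψ y (X y) := fun y ↦ by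
    rw [sub_eq_iff_eq_add, vproj_add_hproj]
  refine ⟨_, ⟨hX.sub (isSmoothField_hproj hM hΨ hX), fun y ↦ ?_⟩, ?_⟩
  · rw [h]
    exact vproj_mem y _
  · rw [h, hXv]
    exact Submodule.starProjection_eq_self_iff.2 hv

end Projections

/-! ### Pointwise algebra of the splitting into D₁, D₂, φD₂ and μ -/

section Algebra

variable {E : Type*} [NormedAddCommGroup E] [NormedSpace ℝ E] [FiniteDimensional ℝ E]
  {M : Type*} [TopologicalSpace M] [ChartedSpace E M] [IsManifold 𝓘(ℝ, E) ∞ M]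
  [RiemannianBundle (fun x : M ↦ TangentSpace 𝓘(ℝ, E) x)]
  {F : Type*} [NormedAddCommGroup F] [NormedSpace ℝ F] [FiniteDimensional ℝ F]
  {N : Type*} [TopologicalSpace N] [ChartedSpace F N] [IsManifold 𝓘(ℝ, F) ∞ N]
  [RiemannianBundle (fun y : N ↦ TangentSpace 𝓘(ℝ, F) y)]
  {φ : Π x : M, TangentSpace 𝓘(ℝ, E) x →L[ℝ] TangentSpace 𝓘(ℝ, E) x}
  {ζ : Π x : M, TangentSpace 𝓘(ℝ, E) x} {η : Π x : M, TangentSpace 𝓘(ℝ, E) x →L[ℝ] ℝ}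
  {Ψ : M → N} {dil : M → ℝ} {D₁ : Π x : M, Submodule ℝ (TangentSpace 𝓘(ℝ, E) x)}

variable (F) in
/-- The part of `μ` orthogonal to the Reeb field. -/
noncomputable def muReebPerp (φ : Π x : M, TangentSpace 𝓘(ℝ, E) x →L[ℝ] TangentSpace 𝓘(ℝ, E) x)
    (η : Π x : M, TangentSpace 𝓘(ℝ, E) x →L[ℝ] ℝ) (Ψ : M → N)
    (D₁ : Π x : M, Submodule ℝ (TangentSpace 𝓘(ℝ, E) x)) (x : M) :
    Submodule ℝ (TangentSpace 𝓘(ℝ, E) x) :=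
  muDist F φ Ψ D₁ x ⊓ LinearMap.ker (η x).toLinearMap

variable {x : M} {u v w : TangentSpace 𝓘(ℝ, E) x}

theorem phi_mem_D₁ (hΨ : IsSicReebPerpSubmersion F φ ζ Ψ dil D₁) (hu : u ∈ D₁ x) :
    φ x u ∈ D₁ x := by
  rw [← hΨ.map_D₁ x]
  exact ⟨u, hu, rfl⟩

theorem phi_mem_horizontal (hΨ : IsSicReebPerpSubmersion F φ ζ Ψ dil D₁)
    (hu : u ∈ antiInvariant F Ψ D₁ x) : φ x u ∈ horizontal F Ψ x :=
  hΨ.map_D₂ x ⟨u, hu, rfl⟩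

theorem eta_vertical (hM : IsAlmostContactMetric φ ζ η)
    (hΨ : IsSicReebPerpSubmersion F φ ζ Ψ dil D₁) (hu : u ∈ vertical F Ψ x) : η x u = 0 := by
  rw [← hM.inner_reeb, inner_vertical_horizontal hu (hΨ.reeb_horizontal x)]

theorem phi_phi_of_eta (hM : IsAlmostContactMetric φ ζ η) (hu : η x u = 0) :
    φ x (φ x u) = -u := by
  rw [hM.phi_phi, hu, zero_smul, add_zero]

theorem inner_phi_phi_of_eta (hM : IsAlmostContactMetric φ ζ η) (hv : η x v = 0) :
    inner ℝ (φ x u) (φ x v) = inner ℝ u v := by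
  rw [hM.inner_phi_phi, hv, mul_zero, sub_zero]

theorem inner_antiInvariant_D₁ (hu : u ∈ antiInvariant F Ψ D₁ x) (hv : v ∈ D₁ x) :
    inner ℝ u v = 0 :=
  Submodule.inner_left_of_mem_orthogonal hv hu.2

/-- `ker Ψ_*` is spanned by `D₁` and `D₂`. -/
theorem exists_add_of_vertical (hΨ : IsSicReebPerpSubmersion F φ ζ Ψ dil D₁)
    (hu : u ∈ vertical F Ψ x) : ∃ a ∈ D₁ x, ∃ b ∈ antiInvariant F Ψ D₁ x, u = a + b :=
  ⟨(D₁ x).starProjection u, Submodule.starProjection_apply_mem _ _,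
    u - (D₁ x).starProjection u,
    ⟨sub_mem hu (hΨ.D₁_le x (Submodule.starProjection_apply_mem _ _)),
      Submodule.sub_starProjection_mem_orthogonal u⟩, by abel⟩

theorem mem_vertical_of_inner (h : ∀ v ∈ horizontal F Ψ x, inner ℝ u v = 0) :
    u ∈ vertical F Ψ x := by
  have h' : u ∈ (vertical F Ψ x)ᗮᗮ := (Submodule.mem_orthogonal' _ _).2 h
  rwa [Submodule.orthogonal_orthogonal] at h'

theorem mem_horizontal_of_inner (h : ∀ v ∈ vertical F Ψ x, inner ℝ u v = 0) :
    u ∈ horizontal F Ψ x :=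
  (Submodule.mem_orthogonal' _ _).2 h

theorem mem_antiInvariant_of_inner (h : ∀ v ∈ horizontal F Ψ x, inner ℝ u v = 0)
    (h' : ∀ v ∈ D₁ x, inner ℝ u v = 0) : u ∈ antiInvariant F Ψ D₁ x :=
  ⟨mem_vertical_of_inner h, (Submodule.mem_orthogonal' _ _).2 h'⟩

theorem mem_D₁_of_inner (hΨ : IsSicReebPerpSubmersion F φ ζ Ψ dil D₁) (hu : u ∈ vertical F Ψ x)
    (h : ∀ v ∈ antiInvariant F Ψ D₁ x, inner ℝ u v = 0) : u ∈ D₁ x := by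
  obtain ⟨a, ha, b, hb, rfl⟩ := exists_add_of_vertical hΨ hu
  have h1 := h b hb
  rw [inner_add_left, real_inner_comm, inner_antiInvariant_D₁ hb ha, zero_add] at h1
  rw [inner_self_eq_zero.1 h1, add_zero]
  exact ha

theorem mem_muDist_of_inner (hu : u ∈ horizontal F Ψ x)
    (h : ∀ v ∈ antiInvariant F Ψ D₁ x, inner ℝ u (φ x v) = 0) : u ∈ muDist F φ Ψ D₁ x := by
  refine ⟨hu, (Submodule.mem_orthogonal' _ _).2 ?_⟩
  rintro _ ⟨v, hv, rfl⟩
  exact h v hv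

theorem inner_muDist_phi (hu : u ∈ muDist F φ Ψ D₁ x) (hv : v ∈ antiInvariant F Ψ D₁ x) :
    inner ℝ u (φ x v) = 0 :=
  Submodule.inner_left_of_mem_orthogonal (K := (antiInvariant F Ψ D₁ x).map (φ x).toLinearMap)
    ⟨v, hv, rfl⟩ hu.2

/-- Skewness of φ moves it onto the test vector: φ sends D₁ into D₁ and D₂ into φD₂, both orthogonal
to `u`. Against φD₂ itself, φ acts isometrically because D₂ is orthogonal to ζ. The Reeb direction
is removed from μ because φ kills it. -/
theorem phi_mem_muReebPerp (hM : IsAlmostContactMetric φ ζ η)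
    (hΨ : IsSicReebPerpSubmersion F φ ζ Ψ dil D₁) (hu : u ∈ muReebPerp F φ η Ψ D₁ x) :
    φ x u ∈ muReebPerp F φ η Ψ D₁ x := by
  refine ⟨mem_muDist_of_inner (mem_horizontal_of_inner fun v hv ↦ ?_) fun v hv ↦ ?_, hM.eta_phi x u⟩
  · obtain ⟨a, ha, b, hb, rfl⟩ := exists_add_of_vertical hΨ hv
    rw [hM.inner_phi, map_add, inner_add_right,
      inner_horizontal_vertical hu.1.1 (hΨ.D₁_le x (phi_mem_D₁ hΨ ha)), inner_muDist_phi hu.1 hb]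
    simp
  · rw [inner_phi_phi_of_eta hM (eta_vertical hM hΨ hv.1), inner_horizontal_vertical hu.1.1 hv.1]

/-- The decomposition `φ Z = α Z + β Z` for `Z` horizontal. -/
theorem betaPart_eq (hM : IsAlmostContactMetric φ ζ η)
    (hΨ : IsSicReebPerpSubmersion F φ ζ Ψ dil D₁) {Z : Π x : M, TangentSpace 𝓘(ℝ, E) x}
    (hZ : Z x ∈ horizontal F Ψ x) :
    betaPart F φ Ψ D₁ Z x = φ x (Z x) - alphaPart F φ Ψ D₁ Z x := by
  have ha : alphaPart F φ Ψ D₁ Z x ∈ antiInvariant F Ψ D₁ x :=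
    Submodule.starProjection_apply_mem _ _
  have hb : φ x (Z x) - alphaPart F φ Ψ D₁ Z x ∈ (antiInvariant F Ψ D₁ x)ᗮ :=
    Submodule.sub_starProjection_mem_orthogonal _
  refine Submodule.eq_starProjection_of_mem_of_inner_eq_zero
    (mem_muDist_of_inner (mem_horizontal_of_inner fun v hv ↦ ?_) fun v hv ↦ ?_) fun v hv ↦ ?_
  · obtain ⟨c, hc, d, hd, rfl⟩ := exists_add_of_vertical hΨ hv
    rw [inner_add_right, Submodule.inner_left_of_mem_orthogonal hd hb, inner_sub_left,
      hM.inner_phi, inner_horizontal_vertical hZ (hΨ.D₁_le x (phi_mem_D₁ hΨ hc)),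
      inner_antiInvariant_D₁ ha hc]
    simp
  · rw [inner_sub_left, inner_phi_phi_of_eta hM (eta_vertical hM hΨ hv.1),
      inner_horizontal_vertical hZ hv.1,
      inner_vertical_horizontal ha.1 (phi_mem_horizontal hΨ hv), sub_zero]
  · rw [sub_sub_cancel, inner_vertical_horizontal ha.1 hv.1]

/-- η kills both φZ and the vertical vector αZ. This makes the last term of condition 2 vanish. -/
theorem betaPart_mem (hM : IsAlmostContactMetric φ ζ η)
    (hΨ : IsSicReebPerpSubmersion F φ ζ Ψ dil D₁) {Z : Π x : M, TangentSpace 𝓘(ℝ, E) x}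
    (hZ : Z x ∈ horizontal F Ψ x) : betaPart F φ Ψ D₁ Z x ∈ muReebPerp F φ η Ψ D₁ x := by
  refine ⟨Submodule.starProjection_apply_mem _ _, ?_⟩
  have ha : alphaPart F φ Ψ D₁ Z x ∈ antiInvariant F Ψ D₁ x :=
    Submodule.starProjection_apply_mem _ _
  change η x _ = 0
  rw [betaPart_eq hM hΨ hZ, map_sub, hM.eta_phi, eta_vertical hM hΨ ha.1, sub_zero]

end Algebra

/-! ### Sasakian identities: ζ is Killing and its flow preserves φ -/

section Sasakian

variable {E : Type*} [NormedAddCommGroup E] [NormedSpace ℝ E] [FiniteDimensional ℝ E]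
  {M : Type*} [TopologicalSpace M] [ChartedSpace E M] [IsManifold 𝓘(ℝ, E) ∞ M]
  [RiemannianBundle (fun x : M ↦ TangentSpace 𝓘(ℝ, E) x)]
  [IsContMDiffRiemannianBundle 𝓘(ℝ, E) ∞ E (fun x : M ↦ TangentSpace 𝓘(ℝ, E) x)]
  {φ : Π x : M, TangentSpace 𝓘(ℝ, E) x →L[ℝ] TangentSpace 𝓘(ℝ, E) x}
  {ζ : Π x : M, TangentSpace 𝓘(ℝ, E) x} {η : Π x : M, TangentSpace 𝓘(ℝ, E) x →L[ℝ] ℝ}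
  {P Q R : Π x : M, TangentSpace 𝓘(ℝ, E) x}

theorem mvfderiv_inner (hQ : IsSmoothField Q) (hR : IsSmoothField R) (x : M) :
    d% (fun y ↦ inner ℝ (Q y) (R y)) x (P x) =
      inner ℝ (nabla P Q x) (R x) + inner ℝ (Q x) (nabla P R x) :=
  leviCivita_metric (hQ.mdiff x) (hR.mdiff x) (P x)

theorem inner_nabla_of_orthogonal (hQ : IsSmoothField Q) (hR : IsSmoothField R)
    (h : ∀ x, inner ℝ (Q x) (R x) = 0) (P : Π x : M, TangentSpace 𝓘(ℝ, E) x) (x : M) :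
    inner ℝ (nabla P Q x) (R x) = -inner ℝ (Q x) (nabla P R x) := by
  have h1 := mvfderiv_inner (P := P) hQ hR x
  have h2 : (fun y ↦ inner ℝ (Q y) (R y)) = fun _ ↦ (0 : ℝ) := funext h
  rw [h2, mvfderiv_const] at h1
  exact eq_neg_of_add_eq_zero_left h1.symm

theorem mlieBracket_eq_nabla (hP : IsSmoothField P) (hQ : IsSmoothField Q) (x : M) :
    mlieBracket 𝓘(ℝ, E) P Q x = nabla P Q x - nabla Q P x :=
  (leviCivita_torsionFree (hP.mdiff x) (hQ.mdiff x)).symm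

theorem IsSasakian.isSmoothField_phi (hM : IsSasakian φ ζ η) (hP : IsSmoothField P) :
    IsSmoothField (fun x ↦ φ x (P x)) := hP.clm_apply hM.smooth_phi

/-- `g(∇_P (φ Q), R) = -g(∇_P Q, φ R)` if `Q` and `R` are orthogonal to `ζ`. -/
theorem IsSasakian.inner_nabla_phi (hM : IsSasakian φ ζ η) (hP : IsSmoothField P)
    (hQ : IsSmoothField Q) {x : M} (hηQ : η x (Q x) = 0) {r : TangentSpace 𝓘(ℝ, E) x}
    (hr : η x r = 0) :
    inner ℝ (nabla P (fun y ↦ φ y (Q y)) x) r = -inner ℝ (nabla P Q x) (φ x r) := by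
  have h := hM.nabla_phi P Q hP hQ x
  rw [sub_eq_iff_eq_add, hηQ, zero_smul, sub_zero] at h
  rw [h, inner_add_left, real_inner_smul_left, real_inner_comm r (ζ x), hM.inner_reeb, hr,
    mul_zero, zero_add, hM.inner_phi]

theorem IsSasakian.inner_nabla_phi_phi (hM : IsSasakian φ ζ η) (hP : IsSmoothField P)
    (hQ : IsSmoothField Q) {x : M} (hηQ : η x (Q x) = 0) {r : TangentSpace 𝓘(ℝ, E) x}
    (hr : η x r = 0) :
    inner ℝ (nabla P (fun y ↦ φ y (Q y)) x) (φ x r) = inner ℝ (nabla P Q x) r := by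
  rw [hM.inner_nabla_phi hP hQ hηQ (hM.eta_phi x r),
    phi_phi_of_eta hM.toIsAlmostContactMetric hr, inner_neg_right, neg_neg]

theorem IsSasakian.reeb_mlieBracket (hM : IsSasakian φ ζ η) (hP : IsSmoothField P) (x : M) :
    mlieBracket 𝓘(ℝ, E) ζ P x = nabla ζ P x + φ x (P x) := by
  rw [mlieBracket_eq_nabla hM.smooth_reeb hP, hM.nabla_reeb P hP, sub_neg_eq_add]

/-- The Reeb field is a Killing field. -/
theorem IsSasakian.reeb_inner (hM : IsSasakian φ ζ η) (hP : IsSmoothField P)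
    (hQ : IsSmoothField Q) (x : M) :
    d% (fun y ↦ inner ℝ (P y) (Q y)) x (ζ x) =
      inner ℝ (mlieBracket 𝓘(ℝ, E) ζ P x) (Q x) +
        inner ℝ (P x) (mlieBracket 𝓘(ℝ, E) ζ Q x) := by
  rw [mvfderiv_inner hP hQ, hM.reeb_mlieBracket hP, hM.reeb_mlieBracket hQ, inner_add_left,
    inner_add_right, hM.inner_phi]
  ring

theorem IsSasakian.inner_reeb_mlieBracket_of_orthogonal (hM : IsSasakian φ ζ η)
    (hP : IsSmoothField P) (hQ : IsSmoothField Q) (h : ∀ x, inner ℝ (P x) (Q x) = 0) (x : M) :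
    inner ℝ (mlieBracket 𝓘(ℝ, E) ζ P x) (Q x) =
      -inner ℝ (P x) (mlieBracket 𝓘(ℝ, E) ζ Q x) := by
  have h1 := hM.reeb_inner hP hQ x
  have h2 : (fun y ↦ inner ℝ (P y) (Q y)) = fun _ ↦ (0 : ℝ) := funext h
  rw [h2, mvfderiv_const] at h1
  exact eq_neg_of_add_eq_zero_left h1.symm

/-- The Reeb flow preserves `φ`. -/
theorem IsSasakian.reeb_phi (hM : IsSasakian φ ζ η) (hP : IsSmoothField P) (x : M) :
    mlieBracket 𝓘(ℝ, E) ζ (fun y ↦ φ y (P y)) x = φ x (mlieBracket 𝓘(ℝ, E) ζ P x) := by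
  have h := hM.nabla_phi ζ P hM.smooth_reeb hP x
  rw [real_inner_comm, hM.inner_reeb, sub_self, sub_eq_zero] at h
  rw [hM.reeb_mlieBracket (hM.isSmoothField_phi hP), hM.reeb_mlieBracket hP, h, map_add]

end Sasakian

/-! ### Koszul-type formulas for horizontally conformal submersions -/

section Conformal

variable {E : Type*} [NormedAddCommGroup E] [NormedSpace ℝ E] [FiniteDimensional ℝ E]
  {M : Type*} [TopologicalSpace M] [ChartedSpace E M] [IsManifold 𝓘(ℝ, E) ∞ M]
  [RiemannianBundle (fun x : M ↦ TangentSpace 𝓘(ℝ, E) x)]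
  [IsContMDiffRiemannianBundle 𝓘(ℝ, E) ∞ E (fun x : M ↦ TangentSpace 𝓘(ℝ, E) x)]
  {F : Type*} [NormedAddCommGroup F] [NormedSpace ℝ F] [FiniteDimensional ℝ F]
  {N : Type*} [TopologicalSpace N] [ChartedSpace F N] [IsManifold 𝓘(ℝ, F) ∞ N]
  [RiemannianBundle (fun y : N ↦ TangentSpace 𝓘(ℝ, F) y)]
  [IsContMDiffRiemannianBundle 𝓘(ℝ, F) ∞ F (fun y : N ↦ TangentSpace 𝓘(ℝ, F) y)]
  {Ψ : M → N} {dil : M → ℝ} {X Y Q W : Π x : M, TangentSpace 𝓘(ℝ, E) x}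

/-- The derivative of `g_N(Ψ_* Y, Ψ_* Q) = λ² g(Y, Q)` for `Y`, `Q` horizontal. -/
theorem IsConformalSubmersion.inner_pullbackNabla_add (hΨ : IsConformalSubmersion E F Ψ dil)
    (hd : CMDiff ∞ (fun x : M ↦ dil x ^ 2)) (X : Π x : M, TangentSpace 𝓘(ℝ, E) x)
    (hY : IsSection (horizontal F Ψ) Y) (hQ : IsSection (horizontal F Ψ) Q) (x : M) :
    inner ℝ (pullbackNabla F Ψ X (fun y ↦ push F Ψ y (Y y)) x) (push F Ψ x (Q x)) +
        inner ℝ (pullbackNabla F Ψ X (fun y ↦ push F Ψ y (Q y)) x) (push F Ψ x (Y x)) =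
      d% (fun y ↦ dil y ^ 2) x (X x) * inner ℝ (Y x) (Q x) +
        dil x ^ 2 * (inner ℝ (nabla X Y x) (Q x) + inner ℝ (nabla X Q x) (Y x)) := by
  have h1 := pullbackNabla_metric ((hΨ.smooth x).mdifferentiableAt (by simp))
    ((contMDiffAt_push hΨ.smooth (hY.1 x)).mdifferentiableAt (by simp))
    ((contMDiffAt_push hΨ.smooth (hQ.1 x)).mdifferentiableAt (by simp)) X
  have h2 : (fun y ↦ inner ℝ (push F Ψ y (Y y)) (push F Ψ y (Q y))) =
      fun y ↦ dil y ^ 2 * inner ℝ (Y y) (Q y) := funext fun y ↦ hΨ.inner_push _ (hQ.2 y)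
  rw [h2, mvfderiv_fun_mul ((hd x).mdifferentiableAt (by simp))
    ((hY.1.contMDiff_inner hQ.1 x).mdifferentiableAt (by simp))] at h1
  simp only [add_apply, smul_apply, smul_eq_mul] at h1
  rw [mvfderiv_inner hY.1 hQ.1] at h1
  rw [real_inner_comm (push F Ψ x (Y x)), ← h1, real_inner_comm (nabla X Q x)]
  ring

/-- Vanishing torsion turns the difference into Ψ_*[X, Y], which is then paired with a horizontal
field by conformality. -/
theorem IsConformalSubmersion.inner_pullbackNabla_sub (hΨ : IsConformalSubmersion E F Ψ dil)
    (hX : IsSmoothField X) (hY : IsSmoothField Y) (hQ : IsSection (horizontal F Ψ) Q) (x : M) :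
    inner ℝ (pullbackNabla F Ψ X (fun y ↦ push F Ψ y (Y y)) x) (push F Ψ x (Q x)) -
        inner ℝ (pullbackNabla F Ψ Y (fun y ↦ push F Ψ y (X y)) x) (push F Ψ x (Q x)) =
      dil x ^ 2 * (inner ℝ (nabla X Y x) (Q x) - inner ℝ (nabla Y X x) (Q x)) := by
  have h1 := pullbackNabla_torsionFree
    ((hΨ.smooth x).of_le (WithTop.coe_le_coe.2 le_top)) (hX.mdiff x) (hY.mdiff x)
  rw [← inner_sub_left, h1, hΨ.inner_push _ (hQ.2 x), mlieBracket_eq_nabla hX hY, inner_sub_left]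

theorem pullbackNabla_vertical (hΨ : ContMDiff 𝓘(ℝ, E) 𝓘(ℝ, F) ∞ Ψ)
    (hW : ∀ x, W x ∈ vertical F Ψ x) (X : Π x : M, TangentSpace 𝓘(ℝ, E) x) (x : M) :
    pullbackNabla F Ψ X (fun y ↦ push F Ψ y (W y)) x = 0 := by
  have h : (fun y ↦ push F Ψ y (W y)) = fun _ ↦ 0 := funext hW
  rw [h, pullbackNabla_zero hΨ.continuous.continuousAt]

/-- The second fundamental form of a horizontally conformal submersion on horizontal fields. -/
theorem IsConformalSubmersion.inner_pullbackNabla (hΨ : IsConformalSubmersion E F Ψ dil)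
    (hd : CMDiff ∞ (fun x : M ↦ dil x ^ 2)) (hX : IsSection (horizontal F Ψ) X)
    (hY : IsSection (horizontal F Ψ) Y) (hQ : IsSection (horizontal F Ψ) Q) (x : M) :
    inner ℝ (pullbackNabla F Ψ X (fun y ↦ push F Ψ y (Y y)) x) (push F Ψ x (Q x)) =
      dil x ^ 2 * inner ℝ (nabla X Y x) (Q x) +
        (d% (fun y ↦ dil y ^ 2) x (X x) * inner ℝ (Y x) (Q x) +
          d% (fun y ↦ dil y ^ 2) x (Y x) * inner ℝ (X x) (Q x) -
          d% (fun y ↦ dil y ^ 2) x (Q x) * inner ℝ (X x) (Y x)) / 2 := by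
  have h1 := hΨ.inner_pullbackNabla_add hd X hY hQ x
  have h2 := hΨ.inner_pullbackNabla_add hd Y hX hQ x
  have h3 := hΨ.inner_pullbackNabla_add hd Q hX hY x
  have h4 := hΨ.inner_pullbackNabla_sub hX.1 hY.1 hQ x
  have h5 := hΨ.inner_pullbackNabla_sub hX.1 hQ.1 hY x
  have h6 := hΨ.inner_pullbackNabla_sub hY.1 hQ.1 hX x
  -- Koszul's computation: the metric identities for `X` and `Y` minus the one for `Q`, with the
  -- three torsion identities absorbing the remaining pullback terms. Only derivatives of λ² survive
  -- as corrections.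
  linarith

/-- The skew-symmetry defect of `∇W`, for `W` vertical, on horizontal fields. -/
theorem IsConformalSubmersion.inner_nabla_vertical (hΨ : IsConformalSubmersion E F Ψ dil)
    (hd : CMDiff ∞ (fun x : M ↦ dil x ^ 2)) (hW : IsSection (vertical F Ψ) W)
    (hX : IsSection (horizontal F Ψ) X) (hY : IsSection (horizontal F Ψ) Y) (x : M) :
    dil x ^ 2 * (inner ℝ (nabla X W x) (Y x) + inner ℝ (nabla Y W x) (X x)) =
      -(d% (fun y ↦ dil y ^ 2) x (W x) * inner ℝ (X x) (Y x)) := by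
  -- Since Ψ_* W = 0, vanishing torsion expresses the pullback derivatives along `W` through
  -- brackets with `W`; the terms in ∇_W X and ∇_W Y then cancel.
  have h1 := hΨ.inner_pullbackNabla_add hd W hX hY x
  have h2 := hΨ.inner_pullbackNabla_sub hW.1 hX.1 hY x
  have h3 := hΨ.inner_pullbackNabla_sub hW.1 hY.1 hX x
  rw [pullbackNabla_vertical hΨ.smooth hW.2, inner_zero_left, sub_zero] at h2 h3
  linarith

end Conformal

/-! ### The Reeb flow and the equivalence between derivatives along D₂ and along φD₂ -/

section ReebFlow

variable {E : Type*} [NormedAddCommGroup E] [NormedSpace ℝ E] [FiniteDimensional ℝ E]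
  {M : Type*} [TopologicalSpace M] [T2Space M] [ChartedSpace E M] [IsManifold 𝓘(ℝ, E) ∞ M]
  [RiemannianBundle (fun x : M ↦ TangentSpace 𝓘(ℝ, E) x)]
  [IsContMDiffRiemannianBundle 𝓘(ℝ, E) ∞ E (fun x : M ↦ TangentSpace 𝓘(ℝ, E) x)]
  {F : Type*} [NormedAddCommGroup F] [NormedSpace ℝ F] [FiniteDimensional ℝ F]
  {N : Type*} [TopologicalSpace N] [ChartedSpace F N] [IsManifold 𝓘(ℝ, F) ∞ N]
  [RiemannianBundle (fun y : N ↦ TangentSpace 𝓘(ℝ, F) y)]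
  [IsContMDiffRiemannianBundle 𝓘(ℝ, F) ∞ F (fun y : N ↦ TangentSpace 𝓘(ℝ, F) y)]
  {φ : Π x : M, TangentSpace 𝓘(ℝ, E) x →L[ℝ] TangentSpace 𝓘(ℝ, E) x}
  {ζ : Π x : M, TangentSpace 𝓘(ℝ, E) x} {η : Π x : M, TangentSpace 𝓘(ℝ, E) x →L[ℝ] ℝ}
  {Ψ : M → N} {dil : M → ℝ} {D₁ : Π x : M, Submodule ℝ (TangentSpace 𝓘(ℝ, E) x)}
  {U V W ξ X Y : Π x : M, TangentSpace 𝓘(ℝ, E) x}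

theorem isSection_reeb (hM : IsSasakian φ ζ η) (hΨ : IsSicReebPerpSubmersion F φ ζ Ψ dil D₁) :
    IsSection (horizontal F Ψ) ζ := ⟨hM.smooth_reeb, hΨ.reeb_horizontal⟩

theorem isSection_phi (hM : IsSasakian φ ζ η) (hΨ : IsSicReebPerpSubmersion F φ ζ Ψ dil D₁)
    (hW : IsSection (antiInvariant F Ψ D₁) W) :
    IsSection (horizontal F Ψ) (fun x ↦ φ x (W x)) :=
  ⟨hM.isSmoothField_phi hW.1, fun x ↦ phi_mem_horizontal hΨ (hW.2 x)⟩

theorem isSection_phi_muReebPerp (hM : IsSasakian φ ζ η)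
    (hΨ : IsSicReebPerpSubmersion F φ ζ Ψ dil D₁) (hY : IsSection (muReebPerp F φ η Ψ D₁) Y) :
    IsSection (muReebPerp F φ η Ψ D₁) (fun x ↦ φ x (Y x)) :=
  ⟨hM.isSmoothField_phi hY.1, fun x ↦ phi_mem_muReebPerp hM.toIsAlmostContactMetric hΨ (hY.2 x)⟩

theorem isSection_antiInvariant_vertical (hW : IsSection (antiInvariant F Ψ D₁) W) :
    IsSection (vertical F Ψ) W := ⟨hW.1, fun x ↦ (hW.2 x).1⟩

theorem isSection_muReebPerp_horizontal (hY : IsSection (muReebPerp F φ η Ψ D₁) Y) :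
    IsSection (horizontal F Ψ) Y := ⟨hY.1, fun x ↦ (hY.2 x).1.1⟩

/-- V is orthogonal to ζ, so the derivative moves onto ζ, where ∇ζ = -φ. -/
theorem inner_nabla_reeb (hM : IsSasakian φ ζ η) (hΨ : IsSicReebPerpSubmersion F φ ζ Ψ dil D₁)
    (hV : IsSection (vertical F Ψ) V) (hX : IsSmoothField X) (x : M) :
    inner ℝ (nabla X V x) (ζ x) = inner ℝ (V x) (φ x (X x)) := by
  rw [inner_nabla_of_orthogonal hV.1 hM.smooth_reeb
    (fun y ↦ inner_vertical_horizontal (hV.2 y) (hΨ.reeb_horizontal y)), hM.nabla_reeb X hX,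
    inner_neg_right, neg_neg]

/-- The dilation is constant along the fibres. -/
theorem mvfderiv_dil_sq_vertical (hM : IsSasakian φ ζ η)
    (hΨ : IsSicReebPerpSubmersion F φ ζ Ψ dil D₁) (hV : IsSection (vertical F Ψ) V) (x : M) :
    d% (fun y ↦ dil y ^ 2) x (V x) = 0 := by
  -- Both horizontal fields are taken to be ζ: then g(∇_ζ V, ζ) = g(V, φζ) = 0, while g(ζ, ζ) = 1.
  have h := hΨ.inner_nabla_vertical (contMDiff_dil_sq hM.toIsAlmostContactMetric hΨ) hV
    (isSection_reeb hM hΨ) (isSection_reeb hM hΨ) x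
  rw [inner_nabla_reeb hM hΨ hV hM.smooth_reeb, hM.phi_reeb, inner_zero_right, hM.inner_reeb,
    hM.eta_reeb] at h
  linarith

/-- The defect of skew-symmetry is proportional to V(λ²), which is zero because λ is constant along
the fibres. -/
theorem inner_nabla_vertical_skew (hM : IsSasakian φ ζ η)
    (hΨ : IsSicReebPerpSubmersion F φ ζ Ψ dil D₁) (hV : IsSection (vertical F Ψ) V)
    (hX : IsSection (horizontal F Ψ) X) (hY : IsSection (horizontal F Ψ) Y) (x : M) :
    inner ℝ (nabla X V x) (Y x) = -inner ℝ (nabla Y V x) (X x) := by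
  have h := hΨ.inner_nabla_vertical (contMDiff_dil_sq hM.toIsAlmostContactMetric hΨ) hV hX hY x
  rw [mvfderiv_dil_sq_vertical hM hΨ hV, zero_mul, neg_zero] at h
  exact eq_neg_of_add_eq_zero_left
    ((mul_eq_zero.1 h).resolve_left (pow_ne_zero 2 (hΨ.dil_pos x).ne'))

/-- The horizontal part of `[ζ, V]` is that of `2 φ V`. -/
theorem inner_reeb_mlieBracket_vertical (hM : IsSasakian φ ζ η)
    (hΨ : IsSicReebPerpSubmersion F φ ζ Ψ dil D₁) (hV : IsSection (vertical F Ψ) V) {x : M}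
    {y : TangentSpace 𝓘(ℝ, E) x} (hy : y ∈ horizontal F Ψ x) :
    inner ℝ (mlieBracket 𝓘(ℝ, E) ζ V x) y = 2 * inner ℝ (φ x (V x)) y := by
  obtain ⟨Y, hY, rfl⟩ := exists_section_horizontal hM.toIsAlmostContactMetric hΨ hy
  rw [hM.reeb_mlieBracket hV.1, inner_add_left,
    inner_nabla_vertical_skew hM hΨ hV (isSection_reeb hM hΨ) hY,
    inner_nabla_reeb hM hΨ hV hY.1, hM.inner_phi]
  ring

theorem reeb_mlieBracket_mem_D₁ (hM : IsSasakian φ ζ η)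
    (hΨ : IsSicReebPerpSubmersion F φ ζ Ψ dil D₁) (hU : IsSection D₁ U) (x : M) :
    mlieBracket 𝓘(ℝ, E) ζ U x ∈ D₁ x := by
  have hvert : ∀ {U}, IsSection D₁ U → mlieBracket 𝓘(ℝ, E) ζ U x ∈ vertical F Ψ x := by
    intro U hU
    refine mem_vertical_of_inner fun y hy ↦ ?_
    rw [inner_reeb_mlieBracket_vertical hM hΨ ⟨hU.1, fun x ↦ hΨ.D₁_le x (hU.2 x)⟩ hy,
      inner_vertical_horizontal (hΨ.D₁_le x (phi_mem_D₁ hΨ (hU.2 x))) hy, mul_zero]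
  refine mem_D₁_of_inner hΨ (hvert hU) fun w hw ↦ ?_
  -- The field φU also lies in D₁, so [ζ, φU] = φ[ζ, U] is vertical and hence orthogonal to φw; by
  -- isometry [ζ, U] is orthogonal to w.
  have h := hvert ⟨hM.isSmoothField_phi hU.1, fun x ↦ phi_mem_D₁ hΨ (hU.2 x)⟩
  rw [← inner_phi_phi_of_eta hM.toIsAlmostContactMetric
    (eta_vertical hM.toIsAlmostContactMetric hΨ hw.1), ← hM.reeb_phi hU.1,
    inner_vertical_horizontal h (phi_mem_horizontal hΨ hw)]

/-- The `D₂`-part of `[ζ, W]` for `W ∈ Γ(D₂)`. -/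
noncomputable def reebDeriv (φ : Π x : M, TangentSpace 𝓘(ℝ, E) x →L[ℝ] TangentSpace 𝓘(ℝ, E) x)
    (ζ W : Π x : M, TangentSpace 𝓘(ℝ, E) x) (x : M) : TangentSpace 𝓘(ℝ, E) x :=
  mlieBracket 𝓘(ℝ, E) ζ W x - (2 : ℝ) • φ x (W x)

/-- Subtracting 2φW removes the horizontal part of [ζ, W]. There is no D₁-component because ζ is
Killing and bracketing with it preserves D₁. -/
theorem isSection_reebDeriv (hM : IsSasakian φ ζ η)
    (hΨ : IsSicReebPerpSubmersion F φ ζ Ψ dil D₁) (hW : IsSection (antiInvariant F Ψ D₁) W) :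
    IsSection (antiInvariant F Ψ D₁) (reebDeriv φ ζ W) := by
  have := FiniteDimensional.complete ℝ E
  refine ⟨(isSmoothField_mlieBracket hM.smooth_reeb hW.1).sub
    ((hM.isSmoothField_phi hW.1).const_smul 2), fun x ↦ mem_antiInvariant_of_inner ?_ ?_⟩
  · intro y hy
    rw [reebDeriv, inner_sub_left, real_inner_smul_left,
      inner_reeb_mlieBracket_vertical hM hΨ (isSection_antiInvariant_vertical hW) hy, sub_self]
  · intro u hu
    obtain ⟨U, hU, rfl⟩ := exists_section_D₁ hΨ hu
    rw [reebDeriv, inner_sub_left, real_inner_smul_left,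
      hM.inner_reeb_mlieBracket_of_orthogonal hW.1 hU.1
        (fun y ↦ inner_antiInvariant_D₁ (hW.2 y) (hU.2 y)),
      inner_antiInvariant_D₁ (hW.2 x) (reeb_mlieBracket_mem_D₁ hM hΨ hU x),
      inner_horizontal_vertical (phi_mem_horizontal hΨ (hW.2 x)) (hΨ.D₁_le x (hU.2 x))]
    simp

theorem reeb_mlieBracket_eq (W : Π x : M, TangentSpace 𝓘(ℝ, E) x) :
    mlieBracket 𝓘(ℝ, E) ζ W = fun x ↦ reebDeriv φ ζ W x + (2 : ℝ) • φ x (W x) := by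
  funext x
  rw [reebDeriv, sub_add_cancel]

theorem reeb_mlieBracket_phi_eq (hM : IsSasakian φ ζ η)
    (hΨ : IsSicReebPerpSubmersion F φ ζ Ψ dil D₁) (hW : IsSection (antiInvariant F Ψ D₁) W) :
    mlieBracket 𝓘(ℝ, E) ζ (fun x ↦ φ x (W x)) =
      fun x ↦ φ x (reebDeriv φ ζ W x) + (-2 : ℝ) • W x := by
  funext x
  rw [hM.reeb_phi hW.1, reeb_mlieBracket_eq (φ := φ), map_add, map_smul,
    phi_phi_of_eta hM.toIsAlmostContactMetric
      (eta_vertical hM.toIsAlmostContactMetric hΨ (hW.2 x).1), smul_neg, neg_smul]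

/-- By the Killing property each component of [ζ, Y] becomes, up to sign, the inner product of Y
with the bracket of ζ and a test field. For test fields in ker Ψ_*, φD₂ and the direction of ζ,
these brackets are known and give zero. -/
theorem isSection_reeb_mlieBracket_muReebPerp (hM : IsSasakian φ ζ η)
    (hΨ : IsSicReebPerpSubmersion F φ ζ Ψ dil D₁) (hY : IsSection (muReebPerp F φ η Ψ D₁) Y) :
    IsSection (muReebPerp F φ η Ψ D₁) (mlieBracket 𝓘(ℝ, E) ζ Y) := by
  have := FiniteDimensional.complete ℝ E
  have hC := hM.toIsAlmostContactMetric
  refine ⟨isSmoothField_mlieBracket hM.smooth_reeb hY.1, fun x ↦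
    ⟨mem_muDist_of_inner (mem_horizontal_of_inner fun v hv ↦ ?_) fun w hw ↦ ?_, ?_⟩⟩
  · obtain ⟨V, hV, rfl⟩ := exists_section_vertical hC hΨ hv
    rw [hM.inner_reeb_mlieBracket_of_orthogonal hY.1 hV.1
      (fun y ↦ inner_horizontal_vertical (hY.2 y).1.1 (hV.2 y)), real_inner_comm,
      inner_reeb_mlieBracket_vertical hM hΨ hV (hY.2 x).1.1, hM.inner_phi,
      inner_vertical_horizontal hv (phi_mem_muReebPerp hC hΨ (hY.2 x)).1.1]
    simp
  · obtain ⟨W, hW, rfl⟩ := exists_section_antiInvariant hC hΨ hw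
    rw [hM.inner_reeb_mlieBracket_of_orthogonal hY.1 (hM.isSmoothField_phi hW.1)
      (fun y ↦ inner_muDist_phi (hY.2 y).1 (hW.2 y)), reeb_mlieBracket_phi_eq hM hΨ hW,
      inner_add_right, real_inner_smul_right,
      inner_muDist_phi (hY.2 x).1 ((isSection_reebDeriv hM hΨ hW).2 x),
      inner_horizontal_vertical (hY.2 x).1.1 hw.1]
    simp
  · change η x _ = 0
    rw [← hM.inner_reeb, hM.inner_reeb_mlieBracket_of_orthogonal hY.1 hM.smooth_reeb
      (fun y ↦ (hM.inner_reeb y _).trans (hY.2 y).2)]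
    simp

theorem mlieBracket_add_smul_left {X' : Π x : M, TangentSpace 𝓘(ℝ, E) x} (hX : IsSmoothField X)
    (hX' : IsSmoothField X') (c : ℝ) (x : M) :
    mlieBracket 𝓘(ℝ, E) (fun y ↦ X y + c • X' y) Y x =
      mlieBracket 𝓘(ℝ, E) X Y x + c • mlieBracket 𝓘(ℝ, E) X' Y x := by
  have := FiniteDimensional.complete ℝ E
  have h := mlieBracket_add_left (W := Y) (hX.mdiff x) ((hX'.const_smul c).mdiff x)
  have h' := mlieBracket_const_smul_left (W := Y) (c := c) (hX'.mdiff x)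
  exact h.trans (congrArg _ h')

theorem mlieBracket_add_smul_right {X' : Π x : M, TangentSpace 𝓘(ℝ, E) x} (hX : IsSmoothField X)
    (hX' : IsSmoothField X') (c : ℝ) (x : M) :
    mlieBracket 𝓘(ℝ, E) Y (fun y ↦ X y + c • X' y) x =
      mlieBracket 𝓘(ℝ, E) Y X x + c • mlieBracket 𝓘(ℝ, E) Y X' x := by
  have := FiniteDimensional.complete ℝ E
  have h := mlieBracket_add_right (V := Y) (hX.mdiff x) ((hX'.const_smul c).mdiff x)
  have h' := mlieBracket_const_smul_right (V := Y) (c := c) (hX'.mdiff x)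
  exact h.trans (congrArg _ h')

/-- Each of the two terms of the bracket contributes -g(∇_{φξ} W, Y), the second one by skewness of
∇W on horizontal vectors. -/
theorem inner_mlieBracket_phi (hM : IsSasakian φ ζ η)
    (hΨ : IsSicReebPerpSubmersion F φ ζ Ψ dil D₁) (hW : IsSection (antiInvariant F Ψ D₁) W)
    (hξ : IsSection (antiInvariant F Ψ D₁) ξ) (hY : IsSection (muReebPerp F φ η Ψ D₁) Y) (x : M) :
    inner ℝ (W x) (mlieBracket 𝓘(ℝ, E) (fun y ↦ φ y (ξ y)) Y x) =
      -2 * inner ℝ (nabla (fun y ↦ φ y (ξ y)) W x) (Y x) := by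
  have hY' := isSection_muReebPerp_horizontal hY
  have hW' := isSection_antiInvariant_vertical hW
  have hφ := isSection_phi hM hΨ hξ
  have h1 := inner_nabla_of_orthogonal hW.1 hY.1
    (fun y ↦ inner_vertical_horizontal (hW'.2 y) (hY'.2 y)) (fun y ↦ φ y (ξ y)) x
  have h2 := inner_nabla_of_orthogonal hW.1 hφ.1
    (fun y ↦ inner_vertical_horizontal (hW'.2 y) (hφ.2 y)) Y x
  have h3 := inner_nabla_vertical_skew hM hΨ hW' hφ hY' x
  rw [mlieBracket_eq_nabla hφ.1 hY.1, inner_sub_right]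
  linarith

/-- Skewness moves the derivative to the direction Y: g(∇_Y W, φξ) is symmetric in W and ξ, because
φ passes through ∇_Y and g(φW, ξ) = 0. -/
theorem inner_nabla_phi_comm (hM : IsSasakian φ ζ η)
    (hΨ : IsSicReebPerpSubmersion F φ ζ Ψ dil D₁) (hW : IsSection (antiInvariant F Ψ D₁) W)
    (hξ : IsSection (antiInvariant F Ψ D₁) ξ) (hY : IsSection (muReebPerp F φ η Ψ D₁) Y) (x : M) :
    inner ℝ (nabla (fun y ↦ φ y (ξ y)) W x) (Y x) =
      inner ℝ (nabla (fun y ↦ φ y (W y)) ξ x) (Y x) := by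
  have hC := hM.toIsAlmostContactMetric
  have hY' := isSection_muReebPerp_horizontal hY
  have hW' := isSection_antiInvariant_vertical hW
  have hξ' := isSection_antiInvariant_vertical hξ
  have h1 := inner_nabla_vertical_skew hM hΨ hW' (isSection_phi hM hΨ hξ) hY' x
  have h2 := inner_nabla_vertical_skew hM hΨ hξ' (isSection_phi hM hΨ hW) hY' x
  have h3 := hM.inner_nabla_phi (Q := W) hY.1 hW.1 (eta_vertical hC hΨ (hW'.2 x))
    (eta_vertical hC hΨ (hξ'.2 x))
  have h4 := inner_nabla_of_orthogonal (hM.isSmoothField_phi hW.1) hξ.1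
    (fun y ↦ inner_horizontal_vertical (phi_mem_horizontal hΨ (hW.2 y)) (hξ'.2 y)) Y x
  rw [real_inner_comm (nabla Y ξ x)] at h4
  linarith

/-- The derivative of `g(W, [φ ξ, Y])` along the Reeb flow. -/
theorem reeb_inner_mlieBracket (hM : IsSasakian φ ζ η)
    (hΨ : IsSicReebPerpSubmersion F φ ζ Ψ dil D₁) (hW : IsSection (antiInvariant F Ψ D₁) W)
    (hξ : IsSection (antiInvariant F Ψ D₁) ξ) (hY : IsSection (muReebPerp F φ η Ψ D₁) Y) (x : M) :
    d% (fun y ↦ inner ℝ (W y) (mlieBracket 𝓘(ℝ, E) (fun z ↦ φ z (ξ z)) Y y)) x (ζ x) =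
      -2 * inner ℝ (nabla (fun y ↦ φ y (ξ y)) (reebDeriv φ ζ W) x) (Y x) -
        2 * inner ℝ (nabla (fun y ↦ φ y (reebDeriv φ ζ ξ y)) W x) (Y x) -
        2 * inner ℝ (nabla (fun y ↦ φ y (ξ y)) W x) (mlieBracket 𝓘(ℝ, E) ζ Y x) +
        2 * inner ℝ (nabla (fun y ↦ φ y (ξ y)) W x) (φ x (Y x)) +
        2 * inner ℝ (nabla ξ W x) (Y x) := by
  have := FiniteDimensional.complete ℝ E
  have hC := hM.toIsAlmostContactMetric
  have hY' := isSection_muReebPerp_horizontal hY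
  have hW' := isSection_antiInvariant_vertical hW
  have hξ' := isSection_antiInvariant_vertical hξ
  have hφW := isSection_phi hM hΨ hW
  have hφξ := isSection_phi hM hΨ hξ
  have hδW := isSection_reebDeriv hM hΨ hW
  have hδξ := isSection_reebDeriv hM hΨ hξ
  have hLY := isSection_reeb_mlieBracket_muReebPerp hM hΨ hY
  -- This bracket is produced by the summand 2φW of [ζ, W], and `e2` by the summand -2ξ of [ζ, φξ].
  -- Their g(W, ∇_Y ξ) terms cancel in the total, leaving 2g(∇_ξ W, Y).
  have e1 : inner ℝ (φ x (W x)) (mlieBracket 𝓘(ℝ, E) (fun y ↦ φ y (ξ y)) Y x) =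
      inner ℝ (nabla (fun y ↦ φ y (ξ y)) W x) (φ x (Y x)) - inner ℝ (W x) (nabla Y ξ x) := by
    have a1 := inner_nabla_of_orthogonal hφW.1 hY.1
      (fun y ↦ real_inner_comm (φ y (W y)) (Y y) ▸ inner_muDist_phi (hY.2 y).1 (hW.2 y))
      (fun y ↦ φ y (ξ y)) x
    have a2 := hM.inner_nabla_phi (Q := W) hφξ.1 hW.1 (eta_vertical hC hΨ (hW'.2 x)) (hY.2 x).2
    have a3 := hM.inner_nabla_phi_phi (Q := ξ) hY.1 hξ.1 (eta_vertical hC hΨ (hξ'.2 x))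
      (eta_vertical hC hΨ (hW'.2 x))
    rw [mlieBracket_eq_nabla hφξ.1 hY.1, inner_sub_right,
      real_inner_comm (nabla Y (fun y ↦ φ y (ξ y)) x), a3, real_inner_comm (W x)]
    linarith
  have e2 : inner ℝ (W x) (mlieBracket 𝓘(ℝ, E) ξ Y x) =
      -inner ℝ (nabla ξ W x) (Y x) - inner ℝ (W x) (nabla Y ξ x) := by
    have a1 := inner_nabla_of_orthogonal hW.1 hY.1
      (fun y ↦ inner_vertical_horizontal (hW'.2 y) (hY'.2 y)) ξ x
    rw [mlieBracket_eq_nabla hξ.1 hY.1, inner_sub_right]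
    linarith
  rw [hM.reeb_inner hW.1 (isSmoothField_mlieBracket hφξ.1 hY.1),
    mlieBracket_jacobi hM.smooth_reeb hφξ.1 hY.1, reeb_mlieBracket_phi_eq hM hΨ hξ,
    mlieBracket_add_smul_left (hM.isSmoothField_phi hδξ.1) hξ.1,
    reeb_mlieBracket_eq (φ := φ) W, inner_add_left, inner_add_right, inner_add_right,
    real_inner_smul_left, real_inner_smul_right, e1, e2,
    inner_mlieBracket_phi hM hΨ hδW hξ hY, inner_mlieBracket_phi hM hΨ hW hδξ hY,
    inner_mlieBracket_phi hM hΨ hW hξ hLY]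
  ring

/-- The derivative of `g([W, φ ξ], Y)` along the Reeb flow. -/
theorem reeb_inner_mlieBracket_phi (hM : IsSasakian φ ζ η)
    (hΨ : IsSicReebPerpSubmersion F φ ζ Ψ dil D₁) (hW : IsSection (antiInvariant F Ψ D₁) W)
    (hξ : IsSection (antiInvariant F Ψ D₁) ξ) (hY : IsSection (muReebPerp F φ η Ψ D₁) Y) (x : M) :
    d% (fun y ↦ inner ℝ (mlieBracket 𝓘(ℝ, E) W (fun z ↦ φ z (ξ z)) y) (Y y)) x (ζ x) =
      inner ℝ (mlieBracket 𝓘(ℝ, E) (reebDeriv φ ζ W) (fun z ↦ φ z (ξ z)) x) (Y x) +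
        inner ℝ (mlieBracket 𝓘(ℝ, E) W (fun z ↦ φ z (reebDeriv φ ζ ξ z)) x) (Y x) +
        inner ℝ (mlieBracket 𝓘(ℝ, E) W (fun z ↦ φ z (ξ z)) x) (mlieBracket 𝓘(ℝ, E) ζ Y x) -
        2 * inner ℝ (mlieBracket 𝓘(ℝ, E) W ξ x) (Y x) := by
  have := FiniteDimensional.complete ℝ E
  have hC := hM.toIsAlmostContactMetric
  have hφW := isSection_phi hM hΨ hW
  have hφξ := isSection_phi hM hΨ hξ
  have hδW := isSection_reebDeriv hM hΨ hW
  have hδξ := isSection_reebDeriv hM hΨ hξ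
  -- The summand 2φW of [ζ, W] contributes nothing: after φ is moved onto Y, the two derivatives
  -- agree by `inner_nabla_phi_comm`.
  have e : inner ℝ (mlieBracket 𝓘(ℝ, E) (fun y ↦ φ y (W y)) (fun y ↦ φ y (ξ y)) x) (Y x) = 0 := by
    have a1 := hM.inner_nabla_phi (Q := ξ) hφW.1 hξ.1 (eta_vertical hC hΨ (hξ.2 x).1) (hY.2 x).2
    have a2 := hM.inner_nabla_phi (Q := W) hφξ.1 hW.1 (eta_vertical hC hΨ (hW.2 x).1) (hY.2 x).2
    have a3 := inner_nabla_phi_comm hM hΨ hW hξ (isSection_phi_muReebPerp hM hΨ hY) x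
    rw [mlieBracket_eq_nabla hφW.1 hφξ.1, inner_sub_left, a1, a2, a3, sub_self]
  rw [hM.reeb_inner (isSmoothField_mlieBracket hW.1 hφξ.1) hY.1,
    mlieBracket_jacobi hM.smooth_reeb hW.1 hφξ.1, reeb_mlieBracket_phi_eq hM hΨ hξ,
    reeb_mlieBracket_eq (φ := φ) W, mlieBracket_add_smul_left hδW.1 hφW.1,
    mlieBracket_add_smul_right (hM.isSmoothField_phi hδξ.1) hξ.1, inner_add_left, inner_add_left,
    inner_add_left, real_inner_smul_left, real_inner_smul_left, e]
  ring

/-- If the `φ D₂`-derivatives of sections of `D₂` have no component in `μ`, then neither have the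
`D₂`-derivatives. -/
theorem inner_nabla_eq_zero_of_phi (hM : IsSasakian φ ζ η)
    (hΨ : IsSicReebPerpSubmersion F φ ζ Ψ dil D₁)
    (h : ∀ W ξ Y, IsSection (antiInvariant F Ψ D₁) W → IsSection (antiInvariant F Ψ D₁) ξ →
      IsSection (muReebPerp F φ η Ψ D₁) Y → ∀ x,
        inner ℝ (nabla (fun y ↦ φ y (ξ y)) W x) (Y x) = 0)
    (hW : IsSection (antiInvariant F Ψ D₁) W) (hξ : IsSection (antiInvariant F Ψ D₁) ξ)
    (hY : IsSection (muReebPerp F φ η Ψ D₁) Y) (x : M) :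
    inner ℝ (nabla W ξ x) (Y x) = 0 := by
  have h1 := reeb_inner_mlieBracket hM hΨ hξ hW hY x
  -- The hypothesis makes the differentiated function vanish identically, along with every term of
  -- its derivative except 2g(∇_W ξ, Y).
  have h0 : (fun y ↦ inner ℝ (ξ y) (mlieBracket 𝓘(ℝ, E) (fun z ↦ φ z (W z)) Y y)) =
      fun _ ↦ (0 : ℝ) := by
    funext y
    rw [inner_mlieBracket_phi hM hΨ hξ hW hY, h ξ W Y hξ hW hY, mul_zero]
  rw [h0, mvfderiv_const, h _ _ _ (isSection_reebDeriv hM hΨ hξ) hW hY,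
    h _ _ _ hξ (isSection_reebDeriv hM hΨ hW) hY,
    h _ _ _ hξ hW (isSection_reeb_mlieBracket_muReebPerp hM hΨ hY),
    h _ _ _ hξ hW (isSection_phi_muReebPerp hM hΨ hY)] at h1
  simpa using h1.symm

/-- If the `D₂`-derivatives of sections of `D₂` have no component in `μ`, then neither have the
`φ D₂`-derivatives. -/
theorem inner_nabla_phi_eq_zero (hM : IsSasakian φ ζ η)
    (hΨ : IsSicReebPerpSubmersion F φ ζ Ψ dil D₁)
    (h : ∀ W ξ Y, IsSection (antiInvariant F Ψ D₁) W → IsSection (antiInvariant F Ψ D₁) ξ →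
      IsSection (muReebPerp F φ η Ψ D₁) Y → ∀ x, inner ℝ (nabla W ξ x) (Y x) = 0)
    (hW : IsSection (antiInvariant F Ψ D₁) W) (hξ : IsSection (antiInvariant F Ψ D₁) ξ)
    (hY : IsSection (muReebPerp F φ η Ψ D₁) Y) (x : M) :
    inner ℝ (nabla (fun y ↦ φ y (ξ y)) W x) (Y x) = 0 := by
  have := FiniteDimensional.complete ℝ E
  have hC := hM.toIsAlmostContactMetric
  have hc : ∀ {W ξ Y}, IsSection (antiInvariant F Ψ D₁) W → IsSection (antiInvariant F Ψ D₁) ξ →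
      IsSection (muReebPerp F φ η Ψ D₁) Y → ∀ x,
        inner ℝ (mlieBracket 𝓘(ℝ, E) W (fun z ↦ φ z (ξ z)) x) (Y x) =
          -inner ℝ (nabla (fun y ↦ φ y (ξ y)) W x) (Y x) := by
    intro W ξ Y hW hξ hY x
    rw [mlieBracket_eq_nabla hW.1 (hM.isSmoothField_phi hξ.1), inner_sub_left,
      hM.inner_nabla_phi hW.1 hξ.1 (eta_vertical hC hΨ (hξ.2 x).1) (hY.2 x).2,
      h _ _ _ hW hξ (isSection_phi_muReebPerp hM hΨ hY)]
    simp
  have key : ∀ {Y}, IsSection (muReebPerp F φ η Ψ D₁) Y →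
      inner ℝ (nabla (fun y ↦ φ y (ξ y)) W x) (φ x (Y x)) = 0 := by
    intro Y hY
    have h1 := reeb_inner_mlieBracket hM hΨ hW hξ hY x
    have h2 := reeb_inner_mlieBracket_phi hM hΨ hW hξ hY x
    -- Two expressions for one function: g(W, [φξ, Y]) = 2g([W, φξ], Y). In their ζ-derivatives the
    -- terms with δW, δξ and [ζ, Y] coincide, and those with ∇_W ξ and ∇_ξ W vanish, which isolates
    -- g(∇_{φξ} W, φY).
    have hf : (fun y ↦ inner ℝ (W y) (mlieBracket 𝓘(ℝ, E) (fun z ↦ φ z (ξ z)) Y y)) =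
        fun y ↦ inner ℝ (mlieBracket 𝓘(ℝ, E) W (fun z ↦ φ z (ξ z)) y) (Y y) +
          inner ℝ (mlieBracket 𝓘(ℝ, E) W (fun z ↦ φ z (ξ z)) y) (Y y) := by
      funext y
      rw [inner_mlieBracket_phi hM hΨ hW hξ hY, hc hW hξ hY]
      ring
    have hd : MDiffAt (fun y ↦ inner ℝ (mlieBracket 𝓘(ℝ, E) W (fun z ↦ φ z (ξ z)) y) (Y y)) x :=
      (((isSmoothField_mlieBracket hW.1 (hM.isSmoothField_phi hξ.1)).contMDiff_inner
        hY.1) x).mdifferentiableAt (by simp)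
    rw [hf, mvfderiv_fun_add hd hd, add_apply, h2, hc (isSection_reebDeriv hM hΨ hW) hξ hY,
      hc hW (isSection_reebDeriv hM hΨ hξ) hY,
      hc hW hξ (isSection_reeb_mlieBracket_muReebPerp hM hΨ hY),
      mlieBracket_eq_nabla hW.1 hξ.1, inner_sub_left, h W ξ Y hW hξ hY, h ξ W Y hξ hW hY] at h1
    linarith
  -- Replacing Y by φY removes the extra φ, since φ²Y = -Y on μ₀.
  have h3 := key (isSection_phi_muReebPerp hM hΨ hY)
  rw [phi_phi_of_eta hC (hY.2 x).2, inner_neg_right, neg_eq_zero] at h3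
  exact h3

end ReebFlow

/-! ### The two conditions in terms of the Levi-Civita connection -/

section Conditions

variable {E : Type*} [NormedAddCommGroup E] [NormedSpace ℝ E] [FiniteDimensional ℝ E]
  {M : Type*} [TopologicalSpace M] [T2Space M] [ChartedSpace E M] [IsManifold 𝓘(ℝ, E) ∞ M]
  [RiemannianBundle (fun x : M ↦ TangentSpace 𝓘(ℝ, E) x)]
  [IsContMDiffRiemannianBundle 𝓘(ℝ, E) ∞ E (fun x : M ↦ TangentSpace 𝓘(ℝ, E) x)]
  {F : Type*} [NormedAddCommGroup F] [NormedSpace ℝ F] [FiniteDimensional ℝ F]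
  {N : Type*} [TopologicalSpace N] [ChartedSpace F N] [IsManifold 𝓘(ℝ, F) ∞ N]
  [RiemannianBundle (fun y : N ↦ TangentSpace 𝓘(ℝ, F) y)]
  [IsContMDiffRiemannianBundle 𝓘(ℝ, F) ∞ F (fun y : N ↦ TangentSpace 𝓘(ℝ, F) y)]
  {φ : Π x : M, TangentSpace 𝓘(ℝ, E) x →L[ℝ] TangentSpace 𝓘(ℝ, E) x}
  {ζ : Π x : M, TangentSpace 𝓘(ℝ, E) x} {η : Π x : M, TangentSpace 𝓘(ℝ, E) x →L[ℝ] ℝ}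
  {Ψ : M → N} {dil : M → ℝ} {D₁ : Π x : M, Submodule ℝ (TangentSpace 𝓘(ℝ, E) x)}
  {A U W ξ Z : Π x : M, TangentSpace 𝓘(ℝ, E) x}

theorem mvfderiv_comp_hasDerivAt {f : M → ℝ} {g : ℝ → ℝ} {g' : ℝ} {x : M} (hf : MDiffAt f x)
    (hg : HasDerivAt g g' (f x)) (v : TangentSpace 𝓘(ℝ, E) x) :
    d% (fun y ↦ g (f y)) x v = d% f x v * g' := by
  have h := mfderiv_comp_apply (I := 𝓘(ℝ, E)) (I' := 𝓘(ℝ, ℝ)) (I'' := 𝓘(ℝ, ℝ)) x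
    hg.differentiableAt.mdifferentiableAt hf v
  refine Eq.trans h ?_
  rw [mfderiv_eq_fderiv, hg.hasFDerivAt.fderiv]
  rfl

theorem mvfderiv_log_dil (hM : IsSasakian φ ζ η) (hΨ : IsSicReebPerpSubmersion F φ ζ Ψ dil D₁)
    (x : M) (v : TangentSpace 𝓘(ℝ, E) x) :
    d% (fun y ↦ dil y ^ 2) x v = 2 * dil x ^ 2 * d% (fun y ↦ Real.log (dil y)) x v := by
  have hd : dil x ^ 2 ≠ 0 := pow_ne_zero 2 (hΨ.dil_pos x).ne'
  have h := mvfderiv_comp_hasDerivAt (f := fun y ↦ dil y ^ 2)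
    ((contMDiff_dil_sq hM.toIsAlmostContactMetric hΨ x).mdifferentiableAt (by simp))
    ((Real.hasDerivAt_log hd).const_mul (1 / 2)) v
  -- Only λ² is known to be differentiable, so ln λ is differentiated as half the logarithm of λ².
  have hlog : (fun y ↦ 1 / 2 * Real.log (dil y ^ 2)) = fun y ↦ Real.log (dil y) := by
    funext y
    rw [Real.log_pow]
    push_cast
    ring
  have hd' : dil x ≠ 0 := (hΨ.dil_pos x).ne'
  rw [hlog] at h
  rw [h]
  field_simp

theorem isSection_alphaPart (hM : IsSasakian φ ζ η) (hΨ : IsSicReebPerpSubmersion F φ ζ Ψ dil D₁)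
    (hZ : IsSmoothField Z) : IsSection (antiInvariant F Ψ D₁) (alphaPart F φ Ψ D₁ Z) :=
  ⟨isSmoothField_antiInvariant hM.toIsAlmostContactMetric hΨ (hM.isSmoothField_phi hZ),
    fun _ ↦ Submodule.starProjection_apply_mem _ _⟩

theorem isSection_betaPart (hM : IsSasakian φ ζ η) (hΨ : IsSicReebPerpSubmersion F φ ζ Ψ dil D₁)
    (hZ : IsSection (horizontal F Ψ) Z) :
    IsSection (muReebPerp F φ η Ψ D₁) (betaPart F φ Ψ D₁ Z) := by
  refine ⟨?_, fun x ↦ betaPart_mem hM.toIsAlmostContactMetric hΨ (hZ.2 x)⟩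
  have h : betaPart F φ Ψ D₁ Z = fun x ↦ φ x (Z x) - alphaPart F φ Ψ D₁ Z x :=
    funext fun x ↦ betaPart_eq hM.toIsAlmostContactMetric hΨ (hZ.2 x)
  rw [h]
  exact (hM.isSmoothField_phi hZ.1).sub (isSection_alphaPart hM hΨ hZ.1).1

/-- On vertical fields T is the horizontal part of ∇_W A. Moving the derivative onto φξ and then φ
onto A gives two sign changes. -/
theorem inner_phi_oneillT (hM : IsSasakian φ ζ η) (hΨ : IsSicReebPerpSubmersion F φ ζ Ψ dil D₁)
    (hW : IsSection (antiInvariant F Ψ D₁) W) (hξ : IsSection (antiInvariant F Ψ D₁) ξ)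
    (hA : IsSection (antiInvariant F Ψ D₁) A) (x : M) :
    inner ℝ (φ x (ξ x)) (oneillT F Ψ W A x) = inner ℝ (nabla W ξ x) (φ x (A x)) := by
  have hC := hM.toIsAlmostContactMetric
  have hv : ∀ {V}, IsSection (antiInvariant F Ψ D₁) V → (fun y ↦ vproj F Ψ y (V y)) = V :=
    fun hV ↦ funext fun y ↦ Submodule.starProjection_eq_self_iff.2 (hV.2 y).1
  have hφ := isSection_phi hM hΨ hξ
  have h1 := inner_nabla_of_orthogonal hφ.1 hA.1
    (fun y ↦ inner_horizontal_vertical (hφ.2 y) (hA.2 y).1) W x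
  have h2 := hM.inner_nabla_phi hW.1 hξ.1 (eta_vertical hC hΨ (hξ.2 x).1)
    (eta_vertical hC hΨ (hA.2 x).1)
  rw [oneillT, hv hW, hv hA, inner_add_right,
    inner_horizontal_vertical (hφ.2 x) (vproj_mem x _), add_zero, real_inner_comm,
    inner_hproj_left _ (hφ.2 x), real_inner_comm]
  linarith

/-- Applying φ to φZ = αZ + βZ recovers Z up to sign and a multiple of ζ, and ∇_W ξ has no
ζ-component because g(ξ, φW) = 0. -/
theorem inner_nabla_horizontal (hM : IsSasakian φ ζ η)
    (hΨ : IsSicReebPerpSubmersion F φ ζ Ψ dil D₁) (hW : IsSection (antiInvariant F Ψ D₁) W)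
    (hξ : IsSection (antiInvariant F Ψ D₁) ξ) (hZ : IsSection (horizontal F Ψ) Z) (x : M) :
    inner ℝ (nabla W ξ x) (Z x) =
      -inner ℝ (φ x (ξ x)) (oneillT F Ψ W (alphaPart F φ Ψ D₁ Z) x) -
        inner ℝ (nabla W ξ x) (φ x (betaPart F φ Ψ D₁ Z x)) := by
  have hC := hM.toIsAlmostContactMetric
  have h0 : inner ℝ (nabla W ξ x) (ζ x) = 0 := by
    rw [inner_nabla_reeb hM hΨ (isSection_antiInvariant_vertical hξ) hW.1,
      inner_vertical_horizontal (hξ.2 x).1 (phi_mem_horizontal hΨ (hW.2 x))]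
  rw [inner_phi_oneillT hM hΨ hW hξ (isSection_alphaPart hM hΨ hZ.1), betaPart_eq hC hΨ (hZ.2 x),
    map_sub, inner_sub_right, hM.phi_phi, inner_add_right, inner_neg_right, real_inner_smul_right,
    h0]
  ring

/-- The covariant derivative of `Ψ_* φ W` along `φ ξ`, in the direction of `Ψ_* φ β Z`. -/
theorem inner_pullbackNabla_phi (hM : IsSasakian φ ζ η)
    (hΨ : IsSicReebPerpSubmersion F φ ζ Ψ dil D₁) (hW : IsSection (antiInvariant F Ψ D₁) W)
    (hξ : IsSection (antiInvariant F Ψ D₁) ξ) (hZ : IsSection (horizontal F Ψ) Z) (x : M) :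
    1 / dil x ^ 2 *
        inner ℝ (pullbackNabla F Ψ (fun y ↦ φ y (ξ y)) (fun y ↦ push F Ψ y (φ y (W y))) x)
          (push F Ψ x (φ x (betaPart F φ Ψ D₁ Z x))) =
      inner ℝ (nabla (fun y ↦ φ y (ξ y)) W x) (betaPart F φ Ψ D₁ Z x) -
        inner ℝ (W x) (ξ x) * inner ℝ (hproj F Ψ x (grad (fun y ↦ Real.log (dil y)) x))
          (φ x (betaPart F φ Ψ D₁ Z x)) := by
  have hC := hM.toIsAlmostContactMetric
  have hd : dil x ≠ 0 := (hΨ.dil_pos x).ne'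
  have hβ := isSection_betaPart hM hΨ hZ
  have hQ := isSection_phi_muReebPerp hM hΨ hβ
  have h := hΨ.inner_pullbackNabla (contMDiff_dil_sq hC hΨ) (isSection_phi hM hΨ hξ)
    (isSection_phi hM hΨ hW) (isSection_muReebPerp_horizontal hQ) x
  -- Of the three derivatives of λ², two are multiplied by inner products of φβZ ∈ μ with φD₂ and
  -- drop out. The third, along φβZ, becomes the gradient term.
  rw [h, real_inner_comm _ (φ x (W x)), inner_muDist_phi (hQ.2 x).1 (hW.2 x),
    real_inner_comm (φ x (betaPart F φ Ψ D₁ Z x)) (φ x (ξ x)),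
    inner_muDist_phi (hQ.2 x).1 (hξ.2 x),
    inner_phi_phi_of_eta hC (eta_vertical hC hΨ (hW.2 x).1),
    hM.inner_nabla_phi_phi (hM.isSmoothField_phi hξ.1) hW.1 (eta_vertical hC hΨ (hW.2 x).1)
      (hβ.2 x).2, mvfderiv_log_dil hM hΨ x (φ x (betaPart F φ Ψ D₁ Z x)),
    inner_hproj_left _ (hQ.2 x).1.1, grad, inner_sharp, real_inner_comm (W x)]
  field_simp
  ring

/-- φ acts isometrically on the two factors, and the derivative moves from U to ξ by orthogonality
of D₁ and D₂. -/
theorem inner_nabla_phi_D₁ (hM : IsSasakian φ ζ η)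
    (hΨ : IsSicReebPerpSubmersion F φ ζ Ψ dil D₁) (hW : IsSection (antiInvariant F Ψ D₁) W)
    (hξ : IsSection (antiInvariant F Ψ D₁) ξ) (hU : IsSection D₁ U) (x : M) :
    inner ℝ (nabla W (fun y ↦ φ y (U y)) x) (φ x (ξ x)) = -inner ℝ (nabla W ξ x) (U x) := by
  have hC := hM.toIsAlmostContactMetric
  rw [hM.inner_nabla_phi_phi hW.1 hU.1 (eta_vertical hC hΨ (hΨ.D₁_le x (hU.2 x)))
    (eta_vertical hC hΨ (hξ.2 x).1), inner_nabla_of_orthogonal hξ.1 hU.1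
    (fun y ↦ inner_antiInvariant_D₁ (hξ.2 y) (hU.2 y)), neg_neg, real_inner_comm]

/-- The first condition says that `∇_W ξ` has no component in `D₁`. -/
theorem secondFundamentalForm_mem_iff (hM : IsSasakian φ ζ η)
    (hΨ : IsSicReebPerpSubmersion F φ ζ Ψ dil D₁) (hW : IsSection (antiInvariant F Ψ D₁) W)
    (hU : IsSection D₁ U) (x : M) :
    secondFundamentalForm F Ψ W (fun y ↦ φ y (U y)) x ∈
        (muDist F φ Ψ D₁ x).map (push F Ψ x).toLinearMap ↔
      ∀ ξ, IsSection (antiInvariant F Ψ D₁) ξ → inner ℝ (nabla W ξ x) (U x) = 0 := by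
  have hC := hM.toIsAlmostContactMetric
  have hs : secondFundamentalForm F Ψ W (fun y ↦ φ y (U y)) x =
      -push F Ψ x (nabla W (fun y ↦ φ y (U y)) x) := by
    rw [secondFundamentalForm, pullbackNabla_vertical hΨ.smooth
      (fun y ↦ hΨ.D₁_le y (phi_mem_D₁ hΨ (hU.2 y))), zero_sub]
  rw [hs]
  constructor
  · rintro ⟨m, hm, hm'⟩ ξ hξ
    have h1 : push F Ψ x m = -push F Ψ x (nabla W (fun y ↦ φ y (U y)) x) := hm'
    have h2 := hΨ.inner_push m (phi_mem_horizontal hΨ (hξ.2 x))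
    rw [h1, inner_neg_left, hΨ.inner_push _ (phi_mem_horizontal hΨ (hξ.2 x)),
      inner_muDist_phi hm (hξ.2 x), inner_nabla_phi_D₁ hM hΨ hW hξ hU] at h2
    have hd : dil x ^ 2 ≠ 0 := pow_ne_zero 2 (hΨ.dil_pos x).ne'
    simpa [hd] using h2
  · intro h
    -- The preimage is the horizontal part, since Ψ_* does not see the vertical one; it lies in μ
    -- once it is orthogonal to φD₂.
    refine ⟨-hproj F Ψ x (nabla W (fun y ↦ φ y (U y)) x), neg_mem (mem_muDist_of_inner
      (hproj_mem x _) fun w hw ↦ ?_), ?_⟩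
    · obtain ⟨ξ, hξ, rfl⟩ := exists_section_antiInvariant hC hΨ hw
      rw [inner_hproj_left _ (phi_mem_horizontal hΨ hw),
        inner_nabla_phi_D₁ hM hΨ hW hξ hU, h ξ hξ, neg_zero]
    · change push F Ψ x _ = _
      rw [map_neg, push_hproj]

/-- The second condition says that the components of `∇_{φ ξ} W` in `μ` are given by `T`. -/
theorem inner_pullbackNabla_phi_eq_iff (hM : IsSasakian φ ζ η)
    (hΨ : IsSicReebPerpSubmersion F φ ζ Ψ dil D₁) (hW : IsSection (antiInvariant F Ψ D₁) W)
    (hξ : IsSection (antiInvariant F Ψ D₁) ξ) (hZ : IsSection (horizontal F Ψ) Z) (x : M) :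
    1 / dil x ^ 2 *
        inner ℝ (pullbackNabla F Ψ (fun y ↦ φ y (ξ y)) (fun y ↦ push F Ψ y (φ y (W y))) x)
          (push F Ψ x (φ x (betaPart F φ Ψ D₁ Z x))) =
      inner ℝ (φ x (ξ x)) (oneillT F Ψ W (alphaPart F φ Ψ D₁ Z) x)
        - inner ℝ (W x) (ξ x) *
            inner ℝ (hproj F Ψ x (grad (fun y ↦ Real.log (dil y)) x))
              (φ x (betaPart F φ Ψ D₁ Z x))
        + η x (betaPart F φ Ψ D₁ Z x) * inner ℝ (W x) (ξ x) ↔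
    inner ℝ (nabla (fun y ↦ φ y (ξ y)) W x) (betaPart F φ Ψ D₁ Z x) =
      inner ℝ (φ x (ξ x)) (oneillT F Ψ W (alphaPart F φ Ψ D₁ Z) x) := by
  have hη : η x (betaPart F φ Ψ D₁ Z x) = 0 := ((isSection_betaPart hM hΨ hZ).2 x).2
  rw [inner_pullbackNabla_phi hM hΨ hW hξ hZ, hη, zero_mul, add_zero, sub_left_inj]

end Conditions

end SicSubmersion

/-! ### The characterization of totally geodesic D₂ -/

theorem mainTheorem10
    {E : Type*} [NormedAddCommGroup E] [NormedSpace ℝ E] [FiniteDimensional ℝ E]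
    {M : Type*} [TopologicalSpace M] [T2Space M] [SecondCountableTopology M]
    [ChartedSpace E M] [IsManifold 𝓘(ℝ, E) ∞ M]
    [RiemannianBundle (fun x : M ↦ TangentSpace 𝓘(ℝ, E) x)]
    [IsContMDiffRiemannianBundle 𝓘(ℝ, E) ∞ E (fun x : M ↦ TangentSpace 𝓘(ℝ, E) x)]
    {F : Type*} [NormedAddCommGroup F] [NormedSpace ℝ F] [FiniteDimensional ℝ F]
    {N : Type*} [TopologicalSpace N] [T2Space N] [SecondCountableTopology N]
    [ChartedSpace F N] [IsManifold 𝓘(ℝ, F) ∞ N]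
    [RiemannianBundle (fun y : N ↦ TangentSpace 𝓘(ℝ, F) y)]
    [IsContMDiffRiemannianBundle 𝓘(ℝ, F) ∞ F (fun y : N ↦ TangentSpace 𝓘(ℝ, F) y)]
    (φ : Π x : M, TangentSpace 𝓘(ℝ, E) x →L[ℝ] TangentSpace 𝓘(ℝ, E) x)
    (ζ : Π x : M, TangentSpace 𝓘(ℝ, E) x)
    (η : Π x : M, TangentSpace 𝓘(ℝ, E) x →L[ℝ] ℝ)
    (hM : IsSasakian φ ζ η)
    (Ψ : M → N) (dil : M → ℝ) (D₁ : Π x : M, Submodule ℝ (TangentSpace 𝓘(ℝ, E) x))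
    (hΨ : IsSicReebPerpSubmersion F φ ζ Ψ dil D₁) :
    DefinesTotallyGeodesicFoliation (antiInvariant F Ψ D₁) ↔
      (∀ W U : Π x : M, TangentSpace 𝓘(ℝ, E) x,
        IsSection (antiInvariant F Ψ D₁) W → IsSection D₁ U → ∀ x,
          secondFundamentalForm F Ψ W (fun y ↦ φ y (U y)) x ∈
            (muDist F φ Ψ D₁ x).map (push F Ψ x).toLinearMap) ∧
      (∀ W ξ Z : Π x : M, TangentSpace 𝓘(ℝ, E) x,
        IsSection (antiInvariant F Ψ D₁) W → IsSection (antiInvariant F Ψ D₁) ξ →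
        IsSection (horizontal F Ψ) Z → ∀ x,
          1 / dil x ^ 2 *
              inner ℝ
                (pullbackNabla F Ψ (fun y ↦ φ y (ξ y)) (fun y ↦ push F Ψ y (φ y (W y))) x)
                (push F Ψ x (φ x (betaPart F φ Ψ D₁ Z x))) =
            inner ℝ (φ x (ξ x)) (oneillT F Ψ W (alphaPart F φ Ψ D₁ Z) x)
              - inner ℝ (W x) (ξ x) *
                  inner ℝ (hproj F Ψ x (grad (fun y ↦ Real.log (dil y)) x))
                    (φ x (betaPart F φ Ψ D₁ Z x))
              + η x (betaPart F φ Ψ D₁ Z x) * inner ℝ (W x) (ξ x)) := by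
  have hC := hM.toIsAlmostContactMetric
  constructor
  · rintro ⟨-, h⟩
    have hzero : ∀ W ξ Y, IsSection (antiInvariant F Ψ D₁) W →
        IsSection (antiInvariant F Ψ D₁) ξ → IsSection (muReebPerp F φ η Ψ D₁) Y → ∀ x,
        inner ℝ (nabla W ξ x) (Y x) = 0 := fun W ξ Y hW hξ hY x ↦
      inner_vertical_horizontal (h W ξ hW hξ x).1 (hY.2 x).1.1
    refine ⟨fun W U hW hU x ↦ (secondFundamentalForm_mem_iff hM hΨ hW hU x).2 fun ξ hξ ↦
      inner_antiInvariant_D₁ (h W ξ hW hξ x) (hU.2 x), fun W ξ Z hW hξ hZ x ↦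
      (inner_pullbackNabla_phi_eq_iff hM hΨ hW hξ hZ x).2 ?_⟩
    have hβ := isSection_betaPart hM hΨ hZ
    have h1 := inner_nabla_horizontal hM hΨ hW hξ hZ x
    rw [inner_vertical_horizontal (h W ξ hW hξ x).1 (hZ.2 x),
      hzero W ξ _ hW hξ (isSection_phi_muReebPerp hM hΨ hβ)] at h1
    -- Both sides of the reduced condition 2 vanish: the left one by the Reeb flow argument, the
    -- right one by `h1`.
    rw [inner_nabla_phi_eq_zero hM hΨ hzero hW hξ hβ]
    linarith
  · rintro ⟨h1, h2⟩
    have hzero : ∀ W ξ Y, IsSection (antiInvariant F Ψ D₁) W →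
        IsSection (antiInvariant F Ψ D₁) ξ → IsSection (muReebPerp F φ η Ψ D₁) Y → ∀ x,
        inner ℝ (nabla (fun y ↦ φ y (ξ y)) W x) (Y x) = 0 := by
      intro W ξ Y hW hξ hY x
      have hφY := isSection_muReebPerp_horizontal (isSection_phi_muReebPerp hM hΨ hY)
      have hφφ : φ x (φ x (Y x)) = -Y x := phi_phi_of_eta hC (hY.2 x).2
      -- Condition 2 is tested on Z = φY: here φZ = -Y lies in μ, so αZ = 0 and βZ = -Y, and the
      -- term with T disappears.
      have hα : alphaPart F φ Ψ D₁ (fun y ↦ φ y (Y y)) x = 0 := by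
        rw [alphaPart, hφφ, Submodule.starProjection_apply_eq_zero_iff]
        exact neg_mem ((Submodule.mem_orthogonal' _ _).2 fun v hv ↦
          inner_horizontal_vertical (hY.2 x).1.1 hv.1)
      have h3 := (inner_pullbackNabla_phi_eq_iff hM hΨ hW hξ hφY x).1 (h2 W ξ _ hW hξ hφY x)
      rw [inner_phi_oneillT hM hΨ hW hξ (isSection_alphaPart hM hΨ hφY.1),
        betaPart_eq hC hΨ (hφY.2 x), hα, hφφ, sub_zero, map_zero, inner_zero_right,
        inner_neg_right, neg_eq_zero] at h3
      exact h3
    have hnabla : ∀ W ξ, IsSection (antiInvariant F Ψ D₁) W →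
        IsSection (antiInvariant F Ψ D₁) ξ → ∀ x, nabla W ξ x ∈ antiInvariant F Ψ D₁ x := by
      intro W ξ hW hξ x
      refine mem_antiInvariant_of_inner (fun z hz ↦ ?_) fun u hu ↦ ?_
      · obtain ⟨Z, hZ, rfl⟩ := exists_section_horizontal hC hΨ hz
        have hβ := isSection_betaPart hM hΨ hZ
        -- For general Z the term in βZ is now known to vanish, so condition 2 kills the term with
        -- T. The remaining g(∇_W ξ, φβZ) vanishes by the Reeb flow argument.
        have h3 := (inner_pullbackNabla_phi_eq_iff hM hΨ hW hξ hZ x).1 (h2 W ξ Z hW hξ hZ x)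
        rw [inner_nabla_horizontal hM hΨ hW hξ hZ, ← h3, hzero W ξ _ hW hξ hβ,
          inner_nabla_eq_zero_of_phi hM hΨ hzero hW hξ (isSection_phi_muReebPerp hM hΨ hβ)]
        simp
      · obtain ⟨U, hU, rfl⟩ := exists_section_D₁ hΨ hu
        exact (secondFundamentalForm_mem_iff hM hΨ hW hU x).1 (h1 W U hW hU x) ξ hξ
    refine ⟨fun W ξ hW hξ x ↦ ?_, hnabla⟩
    -- Involutivity follows from closure under ∇, the connection being torsion-free.
    rw [mlieBracket_eq_nabla hW.1 hξ.1]
    exact sub_mem (hnabla W ξ hW hξ x) (hnabla ξ W hξ hW x)
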